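/- Let $N_f,D_f,N_g,D_g\in\mathbb{R}[x]$ with $D_f(0)=D_g(0)=1$, and put $f=N_f/D_f$, $g=N_g/D_g$. Assume $g(0)=0$ and $g'(0)=1$, so that the origin $O$ is a center of the planar system $$\dot x=y,\qquad \dot y=-g(x)-f(x)y^2. \tag{1}$$ The center $O$ is called isochronous if some punctured neighbourhood of $O$ is filled with periodic orbits which all have the same period. For a real function $h$ that is analytic near $0$, define $$P_0(\xi)=\xi,\qquad P_k(\xi)=P_{k-1}'(\xi)\,(1+h(\xi))-(2k-1)\,P_{k-1}(\xi)\,h'(\xi)\quad(k\ge1),$$ and define polynomials $Q_k$ by $Q_0=N_g$ and, for $k\ge 1$, $$Q_k=Q_{k-1}D_g\bigl((1-k)D_f'+(2-k)N_f\bigr)-k\,Q_{k-1}D_g'D_f+Q_{k-1}'D_gD_f .$$ For every $d\in\mathbb{N}$ there is a positive integer $M_0$ such that for all $N_f,D_f,N_g,D_g$ as above of degree at most $d$, and for every $M\ge M_0$, the following are equivalent: 1. $O$ is an isochronous center of (1); 2. there is an odd real function $h$, analytic near $0$, such that $P_k(0)=Q_k(0)$ for all $0\le k\le M$. Moreover,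 for computing the values $P_k(0)$ and $Q_k(0)$, $0\le k\le M$, it suffices to know the $P_k$ and $Q_k$ up to degree $M-k$: for all $M$, all $h$ analytic near $0$ and all polynomials $N_f,D_f,N_g,D_g$, if in the recursions one replaces $h$ by its Taylor polynomial of degree at most $M$ and deletes, for each $0\le k\le M$, all terms of degree greater than $M-k$ of the $k$-th term before the next one is computed, then the $k$-th polynomials obtained are the truncations at degree $M-k$ of the Taylor series at $0$ of the original $P_k$ and of $Q_k$; in particular they have the values $P_k(0)$ and $Q_k(0)$ at $0$. -/

import Mathlib

open Polynomial Filter Topology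

noncomputable section

/-- `γ` is a solution of `z' = X z`, defined for all times, contained in `V`, non-constant and
periodic with least period `T`. -/
structure IsPeriodicSolution (X : ℝ × ℝ → ℝ × ℝ) (V : Set (ℝ × ℝ)) (γ : ℝ → ℝ × ℝ) (T : ℝ) :
    Prop where
  mem : ∀ t, γ t ∈ V
  hasDerivAt : ∀ t, HasDerivAt γ (X (γ t)) t
  pos : 0 < T
  periodic : Function.Periodic γ T
  minimal : ∀ s, 0 < s → s < T → ¬ Function.Periodic γ s

/-- The point `O` is an isochronous center of the planar vector field `X` with domain `U`:
it is an equilibrium, and it has an open neighbourhood `V ⊆ U` such that `V \ {O}` is filled with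
(non-constant) periodic orbits, all of them with the same least period. -/
def IsIsochronousCenter (U : Set (ℝ × ℝ)) (X : ℝ × ℝ → ℝ × ℝ) (O : ℝ × ℝ) : Prop :=
  X O = 0 ∧ ∃ T : ℝ, ∃ V : Set (ℝ × ℝ), IsOpen V ∧ O ∈ V ∧ V ⊆ U ∧
    ∀ p ∈ V, p ≠ O → ∃ γ : ℝ → ℝ × ℝ, γ 0 = p ∧ IsPeriodicSolution X V γ T

/-- The planar system `x' = y`, `y' = -g(x) - f(x) y²`. -/
def lienardField (f g : ℝ → ℝ) : ℝ × ℝ → ℝ × ℝ :=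
  fun p => (p.2, -g p.1 - f p.1 * p.2 ^ 2)

/-- The rational function `N / D` (meaningful where `D` does not vanish). -/
def ratFun (N D : ℝ[X]) : ℝ → ℝ := fun x => N.eval x / D.eval x

/-- The set of points of the plane at which both denominators are non-zero. -/
def ratDomain (Df Dg : ℝ[X]) : Set (ℝ × ℝ) := {p | Df.eval p.1 ≠ 0 ∧ Dg.eval p.1 ≠ 0}

/-- `h` is (the germ at `0` of) an odd real analytic function. -/
def IsOddAnalytic (h : ℝ → ℝ) : Prop :=
  AnalyticAt ℝ h 0 ∧ ∀ᶠ x in 𝓝 (0 : ℝ), h (-x) = -h x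

/-- The functions `P_k`:
`P_0(ξ) = ξ`, `P_k = P_{k-1}' (1 + h) - (2k - 1) P_{k-1} h'`. -/
def seqP (h : ℝ → ℝ) : ℕ → ℝ → ℝ
  | 0 => fun ξ => ξ
  | k + 1 => fun ξ =>
      deriv (seqP h k) ξ * (1 + h ξ) - (2 * ((k + 1 : ℕ) : ℝ) - 1) * seqP h k ξ * deriv h ξ

/-- The expression that gives `Q_k` in terms of `q = Q_{k-1}`:
`q D_g ((1 - k) D_f' + (2 - k) N_f) - k q D_g' D_f + q' D_g D_f`. -/
def stepQ (Nf Df Dg : ℝ[X]) (k : ℕ) (q : ℝ[X]) : ℝ[X] :=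
  q * Dg * (C (1 - (k : ℝ)) * derivative Df + C (2 - (k : ℝ)) * Nf)
    - C (k : ℝ) * q * derivative Dg * Df + derivative q * Dg * Df

/-- The polynomials `Q_k`, with `Q_0 = N_g`. -/
def seqQ (Nf Df Ng Dg : ℝ[X]) : ℕ → ℝ[X]
  | 0 => Ng
  | k + 1 => stepQ Nf Df Dg (k + 1) (seqQ Nf Df Ng Dg k)

/-- Deletion of all terms of degree greater than `n` of a polynomial. -/
def truncDeg (n : ℕ) (p : ℝ[X]) : ℝ[X] := ∑ i ∈ Finset.range (n + 1), C (p.coeff i) * X ^ i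

/-- The Taylor polynomial at `0`, of degree at most `n`, of a function. -/
def taylorPoly (n : ℕ) (F : ℝ → ℝ) : ℝ[X] :=
  ∑ i ∈ Finset.range (n + 1), C (iteratedDeriv i F 0 / (i.factorial : ℝ)) * X ^ i

/-- The recursion for `P_k` carried out with polynomials only: `h` is replaced by its Taylor
polynomial of degree at most `M`, and the `k`-th term is truncated at degree `M - k` before the
next one is computed (used for `k ≤ M`). -/
def truncSeqP (h : ℝ → ℝ) (M : ℕ) : ℕ → ℝ[X]
  | 0 => truncDeg M X
  | k + 1 => truncDeg (M - (k + 1))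
      (derivative (truncSeqP h M k) * (1 + taylorPoly M h)
        - C (2 * ((k + 1 : ℕ) : ℝ) - 1) * truncSeqP h M k * derivative (taylorPoly M h))

/-- The recursion for `Q_k` where the `k`-th term is truncated at degree `M - k` before the next
one is computed (used for `k ≤ M`). -/
def truncSeqQ (Nf Df Ng Dg : ℝ[X]) (M : ℕ) : ℕ → ℝ[X]
  | 0 => truncDeg M Ng
  | k + 1 => truncDeg (M - (k + 1)) (stepQ Nf Df Dg (k + 1) (truncSeqQ Nf Df Ng Dg M k))

end

/-! Near `0` put `E = exp (∫ f)` and let `Y` be the coordinate with `Y² / 2 = ∫ g E²`. With `1 +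
h(Y) = E / Y'`, the polar coordinates `Y = r sin θ`, `E y = r cos θ` turn the system into `r' = 0`,
`θ' = 1 / (1 + h(r sin θ))`. Orbits are thus circles, and the period is `2π` plus the integral of
`h(r sin s) + h(-r sin s)` over `[0, π]`. It is constant in `r` exactly when `h` is odd
(`isIsochronousCenter_iff`).

For this particular `h`, iterating the operator `E⁻¹ d/dx` on `Y / (1 + h(Y)) = g E` produces the
`P_k` on one side and the `Q_k` on the other, so `P_k(0) = Q_k(0)` for every `k`
(`seqP_zero_eq_seqQ_eval`). This settles one implication for every `M`.

Conversely, `P_{n+2}(0)` is affine in the coefficient of degree `n + 1` of `h`, with slope `-(n + 3)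
(n + 1)!`, and otherwise involves lower coefficients only. So the equations up to `M` fix the
coefficients of `h` up to degree `M - 1`; an odd solution `h'` forces the even ones of the true `h`
to vanish in that range. Since the slopes are rational units, these coefficients are polynomials in
the coefficients of `N_f, D_f, N_g, D_g`, and Hilbert's basis theorem gives a bound, depending on
`d` only, beyond which no even coefficient imposes a new condition (`exists_bound_even_coeff`). -/

noncomputable section

/-! ### The recursions over formal power series, and solving them for `h`. -/

namespace PowerSeries

variable {R : Type*} [CommRing R]

/-- The recursion of `seqP` on formal power series. -/
def pSeq (h : R⟦X⟧) : ℕ → R⟦X⟧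
  | 0 => X
  | k + 1 => d⁄dX R (pSeq h k) * (1 + h) - C (2 * ((k + 1 : ℕ) : R) - 1) * pSeq h k * d⁄dX R h

/-- The recursion of `seqQ` on formal power series. -/
def qSeq (nf df ng dg : R⟦X⟧) : ℕ → R⟦X⟧
  | 0 => ng
  | k + 1 => qSeq nf df ng dg k * dg *
        (C (1 - ((k + 1 : ℕ) : R)) * d⁄dX R df + C (2 - ((k + 1 : ℕ) : R)) * nf)
      - C ((k + 1 : ℕ) : R) * qSeq nf df ng dg k * d⁄dX R dg * df
      + d⁄dX R (qSeq nf df ng dg k) * dg * df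

lemma map_derivative' {S : Type*} [CommRing S] (φ : R →+* S) (a : R⟦X⟧) :
    map φ (d⁄dX R a) = d⁄dX S (map φ a) := by
  ext n
  simp [coeff_derivative]

lemma pSeq_succ (h : R⟦X⟧) (k : ℕ) : pSeq h (k + 1) =
    d⁄dX R (pSeq h k) * (1 + h) - C (2 * ((k + 1 : ℕ) : R) - 1) * pSeq h k * d⁄dX R h := rfl

lemma map_pSeq {S : Type*} [CommRing S] (φ : R →+* S) (h : R⟦X⟧) (k : ℕ) :
    map φ (pSeq h k) = pSeq (map φ h) k := by
  induction k with
  | zero => simp [pSeq]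
  | succ k ih => simp only [pSeq, map_sub, map_mul, map_add, map_one, map_C, map_natCast,
      map_derivative', ih, map_ofNat φ 2]

lemma map_qSeq {S : Type*} [CommRing S] (φ : R →+* S) (nf df ng dg : R⟦X⟧) (k : ℕ) :
    map φ (qSeq nf df ng dg k) = qSeq (map φ nf) (map φ df) (map φ ng) (map φ dg) k := by
  induction k with
  | zero => simp [qSeq]
  | succ k ih => simp only [qSeq, map_sub, map_mul, map_add, map_one, map_C, map_natCast,
      map_derivative', ih, map_ofNat φ 2]

lemma derivative_X_pow_succ_mul (l : ℕ) (w : R⟦X⟧) :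
    d⁄dX R (X ^ (l + 1) * w) = X ^ l * (((l + 1 : ℕ) : R⟦X⟧) * w + X * d⁄dX R w) := by
  rw [Derivation.leibniz, derivative_pow, derivative_X]
  simp only [smul_eq_mul, Nat.add_sub_cancel]
  ring

lemma X_mul_derivative_X_pow_mul (l : ℕ) (w : R⟦X⟧) :
    X * d⁄dX R (X ^ l * w) = X ^ l * ((l : R⟦X⟧) * w + X * d⁄dX R w) := by
  rcases l with _ | l
  · simp
  · rw [derivative_X_pow_succ_mul]
    ring

/-- Each recursion step from `P_2` on differentiates once, so it lowers the order of a perturbation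
of `h` by one; the leading term comes from `P' (1 + h)` alone, the others carry extra powers of `X`.
The step from `P_0` to `P_1` costs no order, hence the start at `P_2`. The parameter `l` is the
order still left, and the factorial keeps the formula free of division. -/
lemma pSeq_add_X_pow_mul {h u : R⟦X⟧} (h0 : constantCoeff h = 0) (m l : ℕ) :
    ∃ w : R⟦X⟧,
      pSeq (h + X ^ (m + l + 1) * u) (m + 2) = pSeq h (m + 2) + X ^ l * w ∧
      constantCoeff w * (l.factorial : R) =
        -(((m + l + 3 : ℕ) : R) * ((m + l + 1).factorial : R)) * constantCoeff u := by
  induction m generalizing l with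
  | zero =>
    have e1 := derivative_X_pow_succ_mul l u
    set v : R⟦X⟧ := ((l + 1 : ℕ) : R⟦X⟧) * u + X * d⁄dX R u with hv
    have e2 := X_mul_derivative_X_pow_mul l v
    have hv0 : constantCoeff v = ((l + 1 : ℕ) : R) * constantCoeff u := by simp [hv]
    -- Both `X h''` and `h'` change at order `l`, with leading coefficients `l (l + 1)` and `l + 1`
    -- times that of `u`; this gives the factor `l + 3`.
    have key : ∀ a : R⟦X⟧, pSeq a 2 = -(X * d⁄dX R (d⁄dX R a)) * (1 + a)
        - 3 * (1 + a - X * d⁄dX R a) * d⁄dX R a := by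
      intro a
      have h3 : (C (2 * ((1 + 1 : ℕ) : R) - 1) : R⟦X⟧) = 3 := by
        rw [← map_ofNat (C : R →+* R⟦X⟧) 3]
        congr 1
        norm_num
      have h1 : (C (2 * ((0 + 1 : ℕ) : R) - 1) : R⟦X⟧) = 1 := by
        rw [← map_one (C : R →+* R⟦X⟧)]
        congr 1
        norm_num
      have p1 : pSeq a 1 = 1 + a - X * d⁄dX R a := by
        rw [pSeq_succ, h1, pSeq, derivative_X]
        ring
      rw [pSeq_succ, h3, p1, map_sub, map_add, derivative_one, Derivation.leibniz, derivative_X,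
        smul_eq_mul, smul_eq_mul]
      ring
    refine ⟨-((l : R⟦X⟧) * v + X * d⁄dX R v) * (1 + (h + X ^ (0 + l + 1) * u))
      - X * d⁄dX R (d⁄dX R h) * X * u
      - 3 * ((X * u - X * v) * (d⁄dX R h + X ^ l * v) + (1 + h - X * d⁄dX R h) * v), ?_, ?_⟩
    · simp only [zero_add, key]
      rw [map_add, e1, map_add, mul_add X (d⁄dX R (d⁄dX R h)), e2]
      ring
    · simp only [map_sub, map_add, map_mul, map_neg, constantCoeff_X, map_natCast, h0, map_one,
        hv0, map_ofNat, map_pow]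
      simp only [zero_add, Nat.factorial_succ]
      push_cast
      ring
  | succ m ih =>
    obtain ⟨w, hw, hw0⟩ := ih (l + 1)
    set n := m + 1 + l with hn
    have hn' : m + (l + 1) = n := by omega
    rw [hn'] at hw hw0
    have e1 := derivative_X_pow_succ_mul n u
    set v : R⟦X⟧ := ((n + 1 : ℕ) : R⟦X⟧) * u + X * d⁄dX R u with hv
    have e2 := derivative_X_pow_succ_mul l w
    refine ⟨(((l + 1 : ℕ) : R⟦X⟧) * w + X * d⁄dX R w) * (1 + (h + X ^ (n + 1) * u))
      + d⁄dX R (pSeq h (m + 2)) * (X ^ (m + 2) * u)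
      - C (2 * ((m + 2 + 1 : ℕ) : R) - 1) * (pSeq h (m + 2) * X ^ (m + 1) * v
        + X * w * (d⁄dX R h + X ^ n * v)), ?_, ?_⟩
    · rw [show m + 1 + 2 = (m + 2) + 1 by ring, pSeq_succ _ (m + 2), hw, map_add, e2, map_add, e1,
        pSeq_succ h (m + 2), hn]
      ring
    · simp only [map_sub, map_add, map_mul, constantCoeff_X, map_natCast, h0, map_one, map_pow]
      rw [← hw0, Nat.factorial_succ l]
      push_cast
      simp
      ring

lemma constantCoeff_pSeq_add_X_pow_mul {h u : R⟦X⟧} (h0 : constantCoeff h = 0) (n : ℕ) :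
    constantCoeff (pSeq (h + X ^ (n + 1) * u) (n + 2)) = constantCoeff (pSeq h (n + 2)) -
      ((n + 3 : ℕ) : R) * ((n + 1).factorial : R) * constantCoeff u := by
  obtain ⟨w, hw, hw0⟩ := pSeq_add_X_pow_mul (u := u) h0 n 0
  simp only [add_zero, Nat.factorial_zero, Nat.cast_one, mul_one, pow_zero, one_mul] at hw hw0
  rw [hw, map_add, hw0]
  ring

lemma exists_eq_add_X_pow_mul {a b : R⟦X⟧} {n : ℕ} (hab : ∀ i < n, coeff i a = coeff i b) :
    ∃ u, a = b + X ^ n * u ∧ constantCoeff u = coeff n a - coeff n b := by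
  obtain ⟨u, hu⟩ : X ^ n ∣ a - b := by
    rw [X_pow_dvd_iff]
    intro i hi
    simp [hab i hi]
  refine ⟨u, by rw [← hu]; ring, ?_⟩
  rw [← map_sub, hu]
  simpa using (coeff_X_pow_mul u n 0).symm

lemma constantCoeff_pSeq_congr_succ {a b : R⟦X⟧} {n : ℕ} (b0 : constantCoeff b = 0)
    (hab : ∀ i ≤ n, coeff i a = coeff i b) :
    constantCoeff (pSeq a (n + 2)) = constantCoeff (pSeq b (n + 2)) -
      ((n + 3 : ℕ) : R) * ((n + 1).factorial : R) * (coeff (n + 1) a - coeff (n + 1) b) := by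
  obtain ⟨u, hu, hu0⟩ := exists_eq_add_X_pow_mul (n := n + 1) fun i hi => hab i (by omega)
  rw [← hu0, ← constantCoeff_pSeq_add_X_pow_mul b0, hu]

/-- The values `P_k(0)`, `k ≤ n + 1`, determine the coefficients of `h` up to degree `n`. -/
lemma coeff_eq_of_constantCoeff_pSeq_eq [IsDomain R] [CharZero R] {a b : R⟦X⟧} {n : ℕ}
    (a0 : constantCoeff a = 0) (b0 : constantCoeff b = 0)
    (hab : ∀ k, 2 ≤ k → k ≤ n + 1 → constantCoeff (pSeq a k) = constantCoeff (pSeq b k)) :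
    ∀ i ≤ n, coeff i a = coeff i b := by
  induction n with
  | zero =>
    intro i hi
    obtain rfl : i = 0 := by omega
    simp [a0, b0]
  | succ n ih =>
    have ih' := ih fun k h2 hk => hab k h2 (by omega)
    intro i hi
    rcases Nat.lt_or_eq_of_le hi with hi | rfl
    · exact ih' i (by omega)
    have := constantCoeff_pSeq_congr_succ b0 ih'
    rw [hab (n + 2) (by omega) le_rfl, eq_comm, sub_eq_self] at this
    rcases mul_eq_zero.1 this with h | h
    · rcases mul_eq_zero.1 h with h | h
      · exact absurd h (Nat.cast_ne_zero.2 (by omega))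
      · exact absurd h (Nat.cast_ne_zero.2 (Nat.factorial_ne_zero _))
    · exact sub_eq_zero.1 h

/-- Approximations of the series `h` with `h(0) = 0` and `P_k(0) = q k` for `k ≥ 2`. -/
def solveApprox [Algebra ℚ R] (q : ℕ → R) : ℕ → R⟦X⟧
  | 0 => 0
  | n + 1 => solveApprox q n + X ^ (n + 1) *
      C (algebraMap ℚ R (((n + 3 : ℕ) : ℚ) * ((n + 1).factorial : ℚ))⁻¹ *
        (constantCoeff (pSeq (solveApprox q n) (n + 2)) - q (n + 2)))

/-- The series `h` with `h(0) = 0` and `P_k(0) = q k` for `k ≥ 2`. -/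
def solve [Algebra ℚ R] (q : ℕ → R) : R⟦X⟧ := mk fun n => coeff n (solveApprox q n)

lemma coeff_solveApprox [Algebra ℚ R] (q : ℕ → R) {i n : ℕ} (hi : i ≤ n) :
    coeff i (solveApprox q n) = coeff i (solve q) := by
  induction n with
  | zero => obtain rfl : i = 0 := by omega
            simp [solve]
  | succ n ih =>
    rcases Nat.lt_or_eq_of_le hi with hi | rfl
    · rw [solveApprox, map_add, coeff_X_pow_mul', if_neg (by omega), add_zero, ih (by omega)]
    · simp [solve]

lemma constantCoeff_solve [Algebra ℚ R] (q : ℕ → R) : constantCoeff (solve q) = 0 := by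
  rw [← coeff_zero_eq_constantCoeff_apply, ← coeff_solveApprox q le_rfl, solveApprox, map_zero]

/-- The term of degree `n + 1` added to the approximation cancels the error in `P_{n+2}(0)`, and
later terms are of too high a degree to affect it. Only rational scalars are inverted, so the
coefficients stay in `R`, which will be a polynomial ring. -/
lemma constantCoeff_pSeq_solve [Algebra ℚ R] (q : ℕ → R) (n : ℕ) :
    constantCoeff (pSeq (solve q) (n + 2)) = q (n + 2) := by
  have h0 : ∀ n, constantCoeff (solveApprox q n) = 0 := fun n => by
    have := coeff_solveApprox q (Nat.zero_le n)
    simpa [constantCoeff_solve] using this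
  rw [constantCoeff_pSeq_congr_succ (h0 n) fun i hi => (coeff_solveApprox q hi).symm,
    ← coeff_solveApprox q le_rfl, solveApprox, map_add, add_sub_cancel_left, coeff_X_pow_mul',
    if_pos le_rfl, Nat.sub_self, coeff_zero_C, ← mul_assoc]
  have : ((n + 3 : ℕ) : R) * ((n + 1).factorial : R) *
      algebraMap ℚ R (((n + 3 : ℕ) : ℚ) * ((n + 1).factorial : ℚ))⁻¹ = 1 := by
    rw [← map_natCast (algebraMap ℚ R), ← map_natCast (algebraMap ℚ R), ← map_mul, ← map_mul,
      mul_inv_cancel₀ (by positivity), map_one]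
  rw [this]
  ring

end PowerSeries

/-! ### Congruence of power series up to a given degree. -/

namespace PowerSeries

variable {R : Type*} [CommRing R]

/-- Two power series have the same coefficients up to degree `n`. -/
def EqUpTo (n : ℕ) (a b : R⟦X⟧) : Prop := ∀ i ≤ n, coeff i a = coeff i b

namespace EqUpTo

variable {n : ℕ} {a b a' b' : R⟦X⟧}

lemma refl (n : ℕ) (a : R⟦X⟧) : EqUpTo n a a := fun _ _ => rfl

lemma mono {m : ℕ} (h : EqUpTo n a b) (hm : m ≤ n) : EqUpTo m a b :=
  fun i hi => h i (hi.trans hm)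

lemma add (h : EqUpTo n a b) (h' : EqUpTo n a' b') : EqUpTo n (a + a') (b + b') :=
  fun i hi => by rw [map_add, map_add, h i hi, h' i hi]

lemma sub (h : EqUpTo n a b) (h' : EqUpTo n a' b') : EqUpTo n (a - a') (b - b') :=
  fun i hi => by rw [map_sub, map_sub, h i hi, h' i hi]

lemma mul (h : EqUpTo n a b) (h' : EqUpTo n a' b') : EqUpTo n (a * a') (b * b') := by
  intro i hi
  rw [coeff_mul, coeff_mul]
  refine Finset.sum_congr rfl fun p hp => ?_
  have := Finset.HasAntidiagonal.mem_antidiagonal.1 hp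
  rw [h _ (by omega), h' _ (by omega)]

lemma derivative (h : EqUpTo (n + 1) a b) : EqUpTo n (d⁄dX R a) (d⁄dX R b) := by
  intro i hi
  rw [coeff_derivative, coeff_derivative, h _ (by omega)]

end EqUpTo

lemma constantCoeff_map' {S : Type*} [CommRing S] (φ : R →+* S) (a : R⟦X⟧) :
    constantCoeff (map φ a) = φ (constantCoeff a) := by
  rw [← coeff_zero_eq_constantCoeff_apply, coeff_map, coeff_zero_eq_constantCoeff_apply]

end PowerSeries

/-! ### Taylor series, and correctness of the truncated recursions. -/

open PowerSeries (EqUpTo pSeq qSeq)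

/-- The Taylor series of `F` at `0`. -/
def taylorSeries (F : ℝ → ℝ) : PowerSeries ℝ :=
  PowerSeries.mk fun i => iteratedDeriv i F 0 / (i.factorial : ℝ)

lemma coeff_taylorSeries (F : ℝ → ℝ) (i : ℕ) :
    PowerSeries.coeff i (taylorSeries F) = iteratedDeriv i F 0 / (i.factorial : ℝ) :=
  PowerSeries.coeff_mk _ _

lemma constantCoeff_taylorSeries (F : ℝ → ℝ) :
    PowerSeries.constantCoeff (taylorSeries F) = F 0 := by
  rw [← PowerSeries.coeff_zero_eq_constantCoeff_apply, coeff_taylorSeries]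
  simp

lemma taylorSeries_deriv (F : ℝ → ℝ) :
    taylorSeries (deriv F) = PowerSeries.derivative ℝ (taylorSeries F) := by
  ext i
  rw [PowerSeries.coeff_derivative, coeff_taylorSeries, coeff_taylorSeries, iteratedDeriv_succ',
    Nat.factorial_succ]
  push_cast
  field_simp

lemma taylorSeries_add {F G : ℝ → ℝ} (hF : AnalyticAt ℝ F 0) (hG : AnalyticAt ℝ G 0) :
    taylorSeries (fun x => F x + G x) = taylorSeries F + taylorSeries G := by
  ext i
  rw [map_add, coeff_taylorSeries, coeff_taylorSeries, coeff_taylorSeries, ← Pi.add_def,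
    iteratedDeriv_add hF.contDiffAt hG.contDiffAt, add_div]

lemma taylorSeries_sub {F G : ℝ → ℝ} (hF : AnalyticAt ℝ F 0) (hG : AnalyticAt ℝ G 0) :
    taylorSeries (fun x => F x - G x) = taylorSeries F - taylorSeries G := by
  ext i
  rw [map_sub, coeff_taylorSeries, coeff_taylorSeries, coeff_taylorSeries, ← Pi.sub_def,
    iteratedDeriv_sub hF.contDiffAt hG.contDiffAt, sub_div]

lemma taylorSeries_congr {F G : ℝ → ℝ} (h : F =ᶠ[𝓝 0] G) : taylorSeries F = taylorSeries G := by
  ext i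
  rw [coeff_taylorSeries, coeff_taylorSeries, h.iteratedDeriv_eq]

/-- Both sides satisfy the Leibniz rule, so the coefficient of degree `i + 1` reduces, through the
derivative, to coefficients of degree `i` of two other products. -/
lemma taylorSeries_mul {F G : ℝ → ℝ} (hF : AnalyticAt ℝ F 0) (hG : AnalyticAt ℝ G 0) :
    taylorSeries (fun x => F x * G x) = taylorSeries F * taylorSeries G := by
  ext i
  induction i generalizing F G with
  | zero =>
    simp [constantCoeff_taylorSeries]
  | succ i ih =>
    have key : taylorSeries (deriv fun x => F x * G x) =
        taylorSeries (fun x => deriv F x * G x) + taylorSeries (fun x => F x * deriv G x) := by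
      refine Eq.trans (taylorSeries_congr ?_)
        (taylorSeries_add (hF.deriv.mul hG) (hF.mul hG.deriv))
      filter_upwards [hF.eventually_analyticAt, hG.eventually_analyticAt] with x h1 h2
      exact deriv_fun_mul h1.differentiableAt h2.differentiableAt
    have := congrArg (PowerSeries.coeff i) key
    rw [map_add, ih hF.deriv hG, ih hF hG.deriv, taylorSeries_deriv, taylorSeries_deriv,
      taylorSeries_deriv, ← map_add, PowerSeries.coeff_derivative] at this
    have h2 : (i + 1 : ℝ) ≠ 0 := by positivity
    apply mul_right_cancel₀ h2
    rw [this, ← PowerSeries.coeff_derivative, Derivation.leibniz]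
    simp only [smul_eq_mul]
    ring_nf

lemma taylorSeries_const (c : ℝ) : taylorSeries (fun _ => c) = PowerSeries.C c := by
  ext i
  rw [coeff_taylorSeries, PowerSeries.coeff_C, iteratedDeriv_const]
  rcases i with _ | i <;> simp

lemma taylorSeries_id : taylorSeries (fun x => x) = PowerSeries.X := by
  ext i
  rw [coeff_taylorSeries, PowerSeries.coeff_X]
  rcases i with _ | i
  · simp
  · rw [iteratedDeriv_succ']
    simp only [deriv_id'', iteratedDeriv_const]
    rcases i with _ | i <;> simp

lemma analyticAt_seqP {h : ℝ → ℝ} {x : ℝ} (hh : AnalyticAt ℝ h x) (k : ℕ) :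
    AnalyticAt ℝ (seqP h k) x := by
  induction k with
  | zero => exact analyticAt_id
  | succ k ih =>
    exact (ih.deriv.mul (analyticAt_const.add hh)).sub ((analyticAt_const.mul ih).mul hh.deriv)

lemma taylorSeries_seqP {h : ℝ → ℝ} (hh : AnalyticAt ℝ h 0) (k : ℕ) :
    taylorSeries (seqP h k) = pSeq (taylorSeries h) k := by
  induction k with
  | zero => exact taylorSeries_id
  | succ k ih =>
    have hk := analyticAt_seqP hh k
    have h1 : AnalyticAt ℝ (fun ξ => deriv (seqP h k) ξ * (1 + h ξ)) 0 :=
      hk.deriv.mul (analyticAt_const.add hh)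
    have h2 : AnalyticAt ℝ (fun ξ => (2 * ((k + 1 : ℕ) : ℝ) - 1) * seqP h k ξ) 0 :=
      analyticAt_const.mul hk
    have h3 : AnalyticAt ℝ (fun ξ => 1 + h ξ) 0 := analyticAt_const.add hh
    rw [PowerSeries.pSeq_succ, seqP]
    refine (taylorSeries_sub h1 (h2.mul hh.deriv)).trans ?_
    rw [taylorSeries_mul hk.deriv h3, taylorSeries_add analyticAt_const hh]
    refine (congrArg _ (taylorSeries_mul h2 hh.deriv)).trans ?_
    rw [taylorSeries_mul analyticAt_const hk, taylorSeries_deriv, taylorSeries_deriv, ih, taylorSeries_const, taylorSeries_const, map_one]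

lemma seqP_zero_eq {h : ℝ → ℝ} (hh : AnalyticAt ℝ h 0) (k : ℕ) :
    seqP h k 0 = PowerSeries.constantCoeff (pSeq (taylorSeries h) k) := by
  rw [← taylorSeries_seqP hh, constantCoeff_taylorSeries]

lemma coe_seqQ (Nf Df Ng Dg : ℝ[X]) (k : ℕ) :
    (seqQ Nf Df Ng Dg k : PowerSeries ℝ) =
      qSeq (Nf : PowerSeries ℝ) (Df : PowerSeries ℝ) (Ng : PowerSeries ℝ) (Dg : PowerSeries ℝ) k := by
  induction k with
  | zero => rfl
  | succ k ih =>
    simp only [seqQ, stepQ, qSeq, coe_sub, coe_add, coe_mul, coe_C, PowerSeries.derivative_coe,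
      ← ih]

lemma seqQ_eval_zero (Nf Df Ng Dg : ℝ[X]) (k : ℕ) :
    (seqQ Nf Df Ng Dg k).eval 0 = PowerSeries.constantCoeff
      (qSeq (Nf : PowerSeries ℝ) (Df : PowerSeries ℝ) (Ng : PowerSeries ℝ) (Dg : PowerSeries ℝ) k) := by
  rw [← coe_seqQ, constantCoeff_coe, coeff_zero_eq_eval_zero]

lemma coeff_truncDeg (n : ℕ) (p : ℝ[X]) (i : ℕ) :
    (truncDeg n p).coeff i = if i ≤ n then p.coeff i else 0 := by
  simp [truncDeg, coeff_C_mul, coeff_X_pow]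

lemma coeff_taylorPoly (n : ℕ) (F : ℝ → ℝ) (i : ℕ) :
    (taylorPoly n F).coeff i = if i ≤ n then PowerSeries.coeff i (taylorSeries F) else 0 := by
  simp [taylorPoly, coeff_C_mul, coeff_X_pow,
    coeff_taylorSeries]

lemma eqUpTo_taylorPoly (n : ℕ) (F : ℝ → ℝ) :
    EqUpTo n (taylorPoly n F : PowerSeries ℝ) (taylorSeries F) := fun i hi => by
  rw [coeff_coe, coeff_taylorPoly, if_pos hi]

lemma eqUpTo_truncDeg (n : ℕ) (p : ℝ[X]) :
    EqUpTo n (truncDeg n p : PowerSeries ℝ) (p : PowerSeries ℝ) := fun i hi => by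
  rw [coeff_coe, coeff_truncDeg, if_pos hi, coeff_coe]

lemma truncDeg_eq_taylorPoly {n : ℕ} {p : ℝ[X]} {F : ℝ → ℝ}
    (h : EqUpTo n (p : PowerSeries ℝ) (taylorSeries F)) : truncDeg n p = taylorPoly n F := by
  ext i
  rw [coeff_truncDeg, coeff_taylorPoly]
  split_ifs with hi
  · rw [← h i hi, coeff_coe]
  · rfl

lemma truncDeg_eq_truncDeg {n : ℕ} {p q : ℝ[X]}
    (h : EqUpTo n (p : PowerSeries ℝ) (q : PowerSeries ℝ)) : truncDeg n p = truncDeg n q := by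
  ext i
  rw [coeff_truncDeg, coeff_truncDeg]
  split_ifs with hi
  · rw [← coeff_coe, ← coeff_coe, h i hi]
  · rfl

/-- A step uses one derivative and otherwise only products, so exactly one degree of accuracy is
lost each time: `M - k` becomes `M - (k + 1)`. -/
lemma truncSeqP_eq {h : ℝ → ℝ} (hh : AnalyticAt ℝ h 0) {M k : ℕ} (hk : k ≤ M) :
    truncSeqP h M k = taylorPoly (M - k) (seqP h k) := by
  induction k with
  | zero =>
    apply truncDeg_eq_taylorPoly
    rw [coe_X, taylorSeries_seqP hh]
    exact EqUpTo.refl _ _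
  | succ k ih =>
    apply truncDeg_eq_taylorPoly
    have hn : M - k = M - (k + 1) + 1 := by omega
    have e1 := eqUpTo_taylorPoly (M - k) (seqP h k)
    rw [← ih (by omega), taylorSeries_seqP hh, hn] at e1
    have e2 : EqUpTo (M - (k + 1) + 1) (taylorPoly M h : PowerSeries ℝ) (taylorSeries h) :=
      (eqUpTo_taylorPoly M h).mono (by omega)
    rw [taylorSeries_seqP hh, PowerSeries.pSeq_succ]
    simp only [coe_sub, coe_mul, coe_add, coe_one, coe_C, ← PowerSeries.derivative_coe]
    exact (e1.derivative.mul ((EqUpTo.refl _ _).add (e2.mono (Nat.le_succ _)))).sub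
      (((EqUpTo.refl _ _).mul (e1.mono (Nat.le_succ _))).mul e2.derivative)

lemma truncSeqP_eval_zero {h : ℝ → ℝ} (hh : AnalyticAt ℝ h 0) {M k : ℕ} (hk : k ≤ M) :
    (truncSeqP h M k).eval 0 = seqP h k 0 := by
  rw [truncSeqP_eq hh hk, ← coeff_zero_eq_eval_zero, coeff_taylorPoly, if_pos (Nat.zero_le _),
    PowerSeries.coeff_zero_eq_constantCoeff_apply, constantCoeff_taylorSeries]

lemma truncSeqQ_eq (Nf Df Ng Dg : ℝ[X]) {M k : ℕ} (hk : k ≤ M) :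
    truncSeqQ Nf Df Ng Dg M k = truncDeg (M - k) (seqQ Nf Df Ng Dg k) := by
  induction k with
  | zero => rfl
  | succ k ih =>
    apply truncDeg_eq_truncDeg
    have hn : M - k = M - (k + 1) + 1 := by omega
    have e1 := eqUpTo_truncDeg (M - k) (seqQ Nf Df Ng Dg k)
    rw [← ih (by omega), hn] at e1
    have e0 := e1.mono (Nat.le_succ _)
    have r := fun p : ℝ[X] => EqUpTo.refl (M - (k + 1)) (p : PowerSeries ℝ)
    simp only [seqQ, stepQ]
    rw [coe_add, coe_add, coe_sub, coe_sub, coe_mul, coe_mul, coe_mul, coe_mul, coe_mul, coe_mul,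
      coe_mul, coe_mul, coe_mul, coe_mul, coe_mul, coe_mul, coe_mul, coe_mul,
      ← PowerSeries.derivative_coe (truncSeqQ _ _ _ _ _ _), ← PowerSeries.derivative_coe (seqQ _ _ _ _ _)]
    exact (((e0.mul (r _)).mul (r _)).sub ((((r _).mul e0).mul (r _)).mul (r _))).add
      ((e1.derivative.mul (r _)).mul (r _))

lemma truncSeqQ_eval_zero (Nf Df Ng Dg : ℝ[X]) {M k : ℕ} (hk : k ≤ M) :
    (truncSeqQ Nf Df Ng Dg M k).eval 0 = (seqQ Nf Df Ng Dg k).eval 0 := by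
  rw [truncSeqQ_eq _ _ _ _ hk, ← coeff_zero_eq_eval_zero, ← coeff_zero_eq_eval_zero,
    coeff_truncDeg, if_pos (Nat.zero_le _)]

/-! ### Generic coefficients and Hilbert's basis theorem. -/

/-- The generic polynomials of degree at most `d`: their coefficients are the variables. -/
def genericPoly (d : ℕ) (j : Fin 4) : PowerSeries (MvPolynomial (Fin 4 × Fin (d + 1)) ℝ) :=
  PowerSeries.mk fun i => if h : i < d + 1 then MvPolynomial.X (j, ⟨i, h⟩) else 0

lemma map_genericPoly {d : ℕ} {p : Fin 4 → ℝ[X]} (j : Fin 4) (hp : (p j).natDegree ≤ d) :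
    PowerSeries.map (MvPolynomial.eval fun x : Fin 4 × Fin (d + 1) => (p x.1).coeff x.2)
      (genericPoly d j) = (p j : PowerSeries ℝ) := by
  ext i
  rw [PowerSeries.coeff_map, genericPoly, PowerSeries.coeff_mk, coeff_coe]
  split_ifs with h
  · simp
  · rw [map_zero, coeff_eq_zero_of_natDegree_lt (by omega)]

/-- The series `h` with `h(0) = 0` and `P_k(0) = Q_k(0)` for `k ≥ 2`, for generic polynomials. -/
def genericSeries (d : ℕ) : PowerSeries (MvPolynomial (Fin 4 × Fin (d + 1)) ℝ) :=
  PowerSeries.solve fun k => PowerSeries.constantCoeff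
    (qSeq (genericPoly d 0) (genericPoly d 1) (genericPoly d 2) (genericPoly d 3) k)

/-- By Hilbert's basis theorem, the vanishing of finitely many of the even coefficients of a
sequence of polynomials in the parameters implies the vanishing of all of them. -/
lemma exists_eval_eq_zero_of_le {σ : Type*} [Finite σ] (c : ℕ → MvPolynomial σ ℝ) :
    ∃ N : ℕ, ∀ x : σ → ℝ, (∀ j ≤ N, MvPolynomial.eval x (c j) = 0) →
      ∀ j, MvPolynomial.eval x (c j) = 0 := by
  let I : ℕ →o Ideal (MvPolynomial σ ℝ) :=
    ⟨fun n => Ideal.span (c '' {j | j ≤ n}), fun m n hmn =>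
      Ideal.span_mono (Set.image_mono fun j (hj : j ≤ m) => hj.trans hmn)⟩
  obtain ⟨N, hN⟩ := monotone_stabilizes_iff_noetherian.2
    (inferInstance : IsNoetherianRing (MvPolynomial σ ℝ)) I
  refine ⟨N, fun x hx j => ?_⟩
  have hle : I N ≤ RingHom.ker (MvPolynomial.eval x) := by
    refine Ideal.span_le.2 ?_
    rintro _ ⟨i, hi, rfl⟩
    exact hx i hi
  have hj : c j ∈ I (max N j) := Ideal.subset_span ⟨j, show j ≤ max N j from le_max_right N j, rfl⟩
  rw [← hN _ (le_max_left _ _)] at hj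
  exact hle hj

/-- The series `a` is the specialization of one generic series whose coefficients are polynomials in
finitely many parameters, so a single bound serves all data of degree at most `d`. -/
lemma exists_bound_even_coeff (d : ℕ) : ∃ M₀ : ℕ, 0 < M₀ ∧ ∀ Nf Df Ng Dg : ℝ[X],
    Nf.natDegree ≤ d → Df.natDegree ≤ d → Ng.natDegree ≤ d → Dg.natDegree ≤ d →
    ∃ a : PowerSeries ℝ, PowerSeries.constantCoeff a = 0 ∧
      (∀ k, 2 ≤ k →
        PowerSeries.constantCoeff (pSeq a k) = (seqQ Nf Df Ng Dg k).eval 0) ∧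
      ((∀ j, 2 * j + 1 ≤ M₀ → PowerSeries.coeff (2 * j) a = 0) →
        ∀ j, PowerSeries.coeff (2 * j) a = 0) := by
  obtain ⟨N, hN⟩ :=
    exists_eval_eq_zero_of_le fun j => PowerSeries.coeff (2 * j) (genericSeries d)
  -- The values `P_k(0)` with `k ≤ 2 N + 1` control `h` up to degree `2 N`, the last even degree
  -- needed.
  refine ⟨2 * N + 1, by omega, fun Nf Df Ng Dg h0 h1 h2 h3 => ?_⟩
  let p : Fin 4 → ℝ[X] := ![Nf, Df, Ng, Dg]
  let x : Fin 4 × Fin (d + 1) → ℝ := fun x => (p x.1).coeff x.2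
  refine ⟨PowerSeries.map (MvPolynomial.eval x) (genericSeries d), ?_, fun k hk => ?_, fun h j => ?_⟩
  · rw [PowerSeries.constantCoeff_map', genericSeries, PowerSeries.constantCoeff_solve, map_zero]
  · obtain ⟨n, rfl⟩ := Nat.exists_eq_add_of_le' hk
    rw [← PowerSeries.map_pSeq, PowerSeries.constantCoeff_map', genericSeries,
      PowerSeries.constantCoeff_pSeq_solve, ← PowerSeries.constantCoeff_map', PowerSeries.map_qSeq,
      map_genericPoly (p := p) 0 h0, map_genericPoly (p := p) 1 h1, map_genericPoly (p := p) 2 h2,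
      map_genericPoly (p := p) 3 h3, seqQ_eval_zero]
    rfl
  · rw [PowerSeries.coeff_map]
    refine hN x (fun i hi => ?_) j
    rw [← PowerSeries.coeff_map]
    exact h i (by omega)

/-! ### Analytic primitives and square roots. -/

lemma AnalyticAt.eventually_eq_zero_of_taylorSeries {F : ℝ → ℝ} (hF : AnalyticAt ℝ F 0)
    (h : taylorSeries F = 0) : ∀ᶠ x in 𝓝 (0 : ℝ), F x = 0 := by
  have h1 := hF.hasFPowerSeriesAt
  have h2 : (fun n : ℕ => iteratedDeriv n F 0 / (n.factorial : ℝ)) = 0 := by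
    funext n
    rw [← coeff_taylorSeries, h, map_zero, Pi.zero_apply]
  rw [h2, FormalMultilinearSeries.ofScalars_series_eq_zero_of_scalar_zero] at h1
  exact h1.eventually_eq_zero

lemma AnalyticAt.eventuallyEq_of_taylorSeries_eq {F G : ℝ → ℝ} (hF : AnalyticAt ℝ F 0)
    (hG : AnalyticAt ℝ G 0) (h : taylorSeries F = taylorSeries G) : F =ᶠ[𝓝 0] G := by
  have := (hF.sub hG).eventually_eq_zero_of_taylorSeries
    ((taylorSeries_sub hF hG).trans (sub_eq_zero.2 h))
  filter_upwards [this] with x hx using sub_eq_zero.1 hx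

/-- An analytic function has an analytic primitive. -/
lemma AnalyticAt.exists_primitive {f : ℝ → ℝ} (hf : AnalyticAt ℝ f 0) :
    ∃ F : ℝ → ℝ, AnalyticAt ℝ F 0 ∧ F 0 = 0 ∧ ∀ᶠ x in 𝓝 (0 : ℝ), deriv F x = f x := by
  set a : ℕ → ℝ := fun n => iteratedDeriv n f 0 / (n.factorial : ℝ) with ha
  set p := FormalMultilinearSeries.ofScalars ℝ a
  have hp : HasFPowerSeriesAt f p 0 := hf.hasFPowerSeriesAt
  -- Termwise integration. At `n = 0` the division by zero returns `0`, which is the wanted value of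
  -- the primitive at `0`.
  set b : ℕ → ℝ := fun n => a (n - 1) / n with hb
  set q := FormalMultilinearSeries.ofScalars ℝ b with hq
  obtain ⟨r, hr0, hr⟩ := ENNReal.lt_iff_exists_nnreal_btwn.1 hp.radius_pos
  obtain ⟨C, hC, hCr⟩ := p.norm_mul_pow_le_of_lt_radius hr
  have hqr : (r : ENNReal) ≤ q.radius := by
    refine q.le_radius_of_bound (C * r) fun n => ?_
    rw [hq, FormalMultilinearSeries.ofScalars_norm]
    rcases n with _ | n
    · simp only [hb, Nat.cast_zero, div_zero, norm_zero, zero_mul]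
      positivity
    · have h1 := hCr n
      rw [FormalMultilinearSeries.ofScalars_norm] at h1
      have h2 : ‖b (n + 1)‖ ≤ ‖a n‖ := by
        simp only [hb, Nat.add_sub_cancel, norm_div]
        apply div_le_self (norm_nonneg _)
        rw [Real.norm_natCast]
        exact_mod_cast Nat.succ_pos n
      calc ‖b (n + 1)‖ * (r : ℝ) ^ (n + 1) ≤ ‖a n‖ * (r : ℝ) ^ (n + 1) := by gcongr
        _ = (‖a n‖ * (r : ℝ) ^ n) * r := by ring
        _ ≤ C * r := by gcongr
  have hF : HasFPowerSeriesAt q.sum q 0 := (q.hasFPowerSeriesOnBall (hr0.trans_le hqr)).hasFPowerSeriesAt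
  have hFa : AnalyticAt ℝ q.sum 0 := ⟨q, hF⟩
  have hcoeff : ∀ n, iteratedDeriv n q.sum 0 / (n.factorial : ℝ) = b n := fun n => by
    have := hF.eq_formalMultilinearSeries hFa.hasFPowerSeriesAt
    rw [← FormalMultilinearSeries.coeff_ofScalars (𝕜 := ℝ)
      (p := fun n => iteratedDeriv n q.sum 0 / (n.factorial : ℝ)), ← this, hq,
      FormalMultilinearSeries.coeff_ofScalars]
  refine ⟨q.sum, hFa, ?_, hFa.deriv.eventuallyEq_of_taylorSeries_eq hf ?_⟩
  · have := hcoeff 0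
    simpa [hb] using this
  · rw [taylorSeries_deriv]
    ext n
    rw [PowerSeries.coeff_derivative, coeff_taylorSeries, hcoeff, coeff_taylorSeries]
    simp only [hb, ha, Nat.add_sub_cancel]
    push_cast
    field_simp

lemma AnalyticAt.dslope_zero {f : ℝ → ℝ} (hf : AnalyticAt ℝ f 0) : AnalyticAt ℝ (dslope f 0) 0 := by
  obtain ⟨p, hp⟩ := hf
  exact ⟨_, hp.has_fpower_series_dslope_fslope⟩

lemma eq_mul_dslope_zero {f : ℝ → ℝ} (h0 : f 0 = 0) (x : ℝ) : f x = x * dslope f 0 x := by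
  have := sub_smul_dslope f 0 x
  simpa [h0] using this.symm

/-- The square root of twice an analytic function with a nondegenerate minimum. -/
lemma AnalyticAt.exists_sq_eq {V : ℝ → ℝ} (hV : AnalyticAt ℝ V 0) (h0 : V 0 = 0)
    (h1 : deriv V 0 = 0) (h2 : deriv (deriv V) 0 = 1) :
    ∃ Y : ℝ → ℝ, AnalyticAt ℝ Y 0 ∧ Y 0 = 0 ∧ deriv Y 0 = 1 ∧
      ∀ᶠ x in 𝓝 (0 : ℝ), Y x ^ 2 = 2 * V x := by
  set A := dslope V 0 with hA
  have hAa : AnalyticAt ℝ A 0 := hV.dslope_zero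
  have hA0 : A 0 = 0 := by rw [hA, dslope_same, h1]
  set B := dslope A 0 with hB
  have hBa : AnalyticAt ℝ B 0 := hAa.dslope_zero
  have hVB : V = fun x => x ^ 2 * B x := by
    funext x
    rw [eq_mul_dslope_zero h0, ← hA, eq_mul_dslope_zero hA0]
    ring
  have hB0 : B 0 = 1 / 2 := by
    have e1 : deriv V =ᶠ[𝓝 0] fun x => 2 * x * B x + x ^ 2 * deriv B x := by
      filter_upwards [hBa.eventually_analyticAt] with x hx
      rw [hVB]
      have := ((hasDerivAt_id' x).fun_pow 2).fun_mul hx.differentiableAt.hasDerivAt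
      simpa using this.deriv
    rw [e1.deriv_eq] at h2
    have := (((hasDerivAt_id' (0 : ℝ)).const_mul 2).fun_mul hBa.differentiableAt.hasDerivAt).fun_add
      (((hasDerivAt_id' (0 : ℝ)).fun_pow 2).fun_mul hBa.deriv.differentiableAt.hasDerivAt)
    have h3 := this.deriv
    simp only [mul_one, mul_zero, zero_mul, add_zero, ne_eq, OfNat.ofNat_ne_zero,
      not_false_eq_true, zero_pow, Nat.add_one_sub_one, pow_one] at h3
    linarith
  -- With `V = x² B` and `B(0) = 1 / 2`, the root is `Y = x √(2 B)`; writing it with `exp` and `log`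
  -- makes analyticity immediate.
  set S : ℝ → ℝ := fun x => Real.exp (Real.log (2 * B x) / 2) with hS
  have hSa : AnalyticAt ℝ S 0 := by
    have : AnalyticAt ℝ (fun x => Real.log (2 * B x) / 2) 0 :=
      ((analyticAt_const.mul hBa).log (by simp [hB0])).div_const
    exact this.rexp
  have hS0 : S 0 = 1 := by simp [hS, hB0]
  refine ⟨fun x => x * S x, analyticAt_id.mul hSa, by simp, ?_, ?_⟩
  · have := (hasDerivAt_id (0 : ℝ)).mul hSa.differentiableAt.hasDerivAt
    simp only [id, one_mul, zero_mul, add_zero, hS0] at this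
    exact this.deriv
  · have hpos : ∀ᶠ x in 𝓝 (0 : ℝ), 0 < 2 * B x :=
      ContinuousAt.eventually_lt continuousAt_const (continuousAt_const.mul hBa.continuousAt)
        (by simp [hB0])
    filter_upwards [hpos] with x hx
    have hS2 : S x ^ 2 = 2 * B x := by
      rw [hS, ← Real.exp_nat_mul]
      push_cast
      rw [mul_div_cancel₀ _ two_ne_zero, Real.exp_log hx]
    rw [hVB, mul_pow, hS2]
    ring

/-! ### Urabe's normal form and the identity `P_k(0) = Q_k(0)`. -/

/-- The data of Urabe's normal form at `0` of the system `x' = y`, `y' = -g(x) - f(x) y²`: the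
integrating factor `E = exp (∫ f)`, the coordinate `Y` with `Y² / 2 = ∫ g E²`, and the function
`h` with `1 + h(Y) = E / Y'`. -/
structure UrabeForm (f g E Y h : ℝ → ℝ) : Prop where
  analyticAt_E : AnalyticAt ℝ E 0
  analyticAt_Y : AnalyticAt ℝ Y 0
  analyticAt_h : AnalyticAt ℝ h 0
  E_zero : E 0 = 1
  Y_zero : Y 0 = 0
  deriv_Y_zero : deriv Y 0 = 1
  h_zero : h 0 = 0
  deriv_E : ∀ᶠ x in 𝓝 (0 : ℝ), deriv E x = f x * E x
  Y_mul_deriv : ∀ᶠ x in 𝓝 (0 : ℝ), Y x * deriv Y x = g x * E x ^ 2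
  one_add_h : ∀ᶠ x in 𝓝 (0 : ℝ), (1 + h (Y x)) * deriv Y x = E x

/-- The potential `V = ∫ g E²` has a nondegenerate minimum because `g(0) = 0` and `g'(0) = 1`, so `Y
= ± √(2 V)` is an analytic coordinate and `h` is read off through its local inverse. -/
lemma exists_urabeForm {f g : ℝ → ℝ} (hf : AnalyticAt ℝ f 0) (hg : AnalyticAt ℝ g 0)
    (g0 : g 0 = 0) (g1 : deriv g 0 = 1) : ∃ E Y h, UrabeForm f g E Y h := by
  obtain ⟨F, hF, F0, hFf⟩ := hf.exists_primitive
  have hE : AnalyticAt ℝ (fun x => Real.exp (F x)) 0 := hF.rexp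
  set E : ℝ → ℝ := fun x => Real.exp (F x) with hEdef
  have hE0 : E 0 = 1 := by simp [hEdef, F0]
  have hgE : AnalyticAt ℝ (fun x => g x * E x ^ 2) 0 := hg.mul (hE.pow 2)
  obtain ⟨V, hV, V0, hVg⟩ := hgE.exists_primitive
  have hV1 : deriv V 0 = 0 := by rw [hVg.self_of_nhds, g0, zero_mul]
  have hV2 : deriv (deriv V) 0 = 1 := by
    have e : deriv V =ᶠ[𝓝 0] fun x => g x * E x ^ 2 := hVg
    rw [e.deriv_eq]
    have := (hg.differentiableAt.hasDerivAt.fun_mul (hE.differentiableAt.hasDerivAt.fun_pow 2)).deriv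
    rw [this, g0, g1, hE0]
    simp
  obtain ⟨Y, hY, Y0, Y1, hYV⟩ := hV.exists_sq_eq V0 hV1 hV2
  have hY1 : deriv Y 0 ≠ 0 := by rw [Y1]; exact one_ne_zero
  set ψ := hY.hasStrictDerivAt.localInverse _ _ _ hY1 with hψ
  have hψa : AnalyticAt ℝ ψ 0 := by simpa only [Y0] using hY.analyticAt_localInverse hY1
  have hψY : ∀ᶠ x in 𝓝 (0 : ℝ), ψ (Y x) = x := hY.hasStrictDerivAt.eventually_left_inverse hY1
  have hψ0 : ψ 0 = 0 := by simpa only [Y0] using hψY.self_of_nhds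
  have hE' : AnalyticAt ℝ E (ψ 0) := by rwa [hψ0]
  have hY' : AnalyticAt ℝ (deriv Y) (ψ 0) := by rw [hψ0]; exact hY.deriv
  refine ⟨E, Y, fun ξ => E (ψ ξ) / deriv Y (ψ ξ) - 1, hE, hY, ?_, hE0, Y0, Y1, ?_, ?_, ?_, ?_⟩
  · exact ((hE'.comp hψa).div (hY'.comp hψa) (by simp [hψ0, Y1])).sub analyticAt_const
  · simp only [hψ0, hE0, Y1]
    norm_num
  · filter_upwards [hFf, hF.eventually_analyticAt] with x hx hx'
    rw [← hx, mul_comm]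
    exact hx'.differentiableAt.hasDerivAt.exp.deriv
  · filter_upwards [hVg, hYV.eventually_nhds, hY.eventually_analyticAt, hV.eventually_analyticAt]
      with x h1 h2 h3 h4
    rw [← h1]
    have e : (fun x => Y x ^ 2) =ᶠ[𝓝 x] fun x => 2 * V x := h2
    have := e.deriv_eq
    rw [(h3.differentiableAt.hasDerivAt.fun_pow 2).deriv,
      (h4.differentiableAt.hasDerivAt.const_mul 2).deriv] at this
    push_cast at this
    linarith
  · have hne : ∀ᶠ x in 𝓝 (0 : ℝ), deriv Y x ≠ 0 := hY.deriv.continuousAt.eventually_ne hY1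
    filter_upwards [hψY, hne] with x h1 h2
    rw [h1]
    field_simp
    ring

/-- Dividing by `u x` avoids the truncated exponent `k - 1`, so that `k` can stay symbolic. -/
lemma HasDerivAt.pow_of_ne_zero {u : ℝ → ℝ} {u' x : ℝ} (hu : HasDerivAt u u' x) (h0 : u x ≠ 0)
    (k : ℕ) : HasDerivAt (fun x => u x ^ k) (k * u x ^ k * u' / u x) x := by
  refine (hu.fun_pow k).congr_deriv ?_
  rcases k with _ | k
  · simp
  · rw [Nat.add_sub_cancel]
    field_simp
    ring

lemma seqP_zero_eq_seqQ_eval {Nf Df Ng Dg : ℝ[X]} {E Y h : ℝ → ℝ}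
    (H : UrabeForm (ratFun Nf Df) (ratFun Ng Dg) E Y h) (hDf : Df.eval 0 = 1)
    (hDg : Dg.eval 0 = 1) (k : ℕ) : seqP h k 0 = (seqQ Nf Df Ng Dg k).eval 0 := by
  have hYc : Tendsto Y (𝓝 0) (𝓝 0) := by simpa [H.Y_zero] using H.analyticAt_Y.continuousAt.tendsto
  have nDf : ∀ᶠ x in 𝓝 (0 : ℝ), Df.eval x ≠ 0 :=
    Df.continuous.continuousAt.eventually_ne (by rw [hDf]; exact one_ne_zero)
  have nDg : ∀ᶠ x in 𝓝 (0 : ℝ), Dg.eval x ≠ 0 :=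
    Dg.continuous.continuousAt.eventually_ne (by rw [hDg]; exact one_ne_zero)
  have nE : ∀ᶠ x in 𝓝 (0 : ℝ), E x ≠ 0 :=
    H.analyticAt_E.continuousAt.eventually_ne (by rw [H.E_zero]; exact one_ne_zero)
  have nh : ∀ᶠ x in 𝓝 (0 : ℝ), 1 + h (Y x) ≠ 0 := by
    filter_upwards [H.one_add_h, nE] with x h1 h2 h3
    rw [h3, zero_mul] at h1
    exact h2 h1.symm
  -- Both sides are the `k`-th iterate of `E⁻¹ d/dx` on `g E`: on the left through `Y' = E / (1 +
  -- h(Y))`, on the right through `E' = f E`. At `x = 0` every factor other than `P_k` and `Q_k`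
  -- equals `1`.
  have key : ∀ k, ∀ᶠ x in 𝓝 (0 : ℝ), seqP h k (Y x) / (1 + h (Y x)) ^ (2 * k + 1) =
      (seqQ Nf Df Ng Dg k).eval x * E x / (Df.eval x ^ k * Dg.eval x ^ (k + 1) * E x ^ k) := by
    intro k
    induction k with
    | zero =>
      filter_upwards [H.one_add_h, H.Y_mul_deriv, nDg, nE, nh] with x h1 h2 h3 h4 h5
      simp only [seqP, seqQ, ratFun, mul_zero, zero_add, pow_one, pow_zero, one_mul, mul_one] at h2 ⊢
      have h6 : deriv Y x = E x / (1 + h (Y x)) := by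
        rw [eq_div_iff h5, mul_comm, h1]
      rw [h6] at h2
      field_simp at h2 ⊢
      linarith
    | succ k ih =>
      filter_upwards [ih.eventually_nhds, H.one_add_h, H.deriv_E, nDf, nDg, nE, nh,
        H.analyticAt_Y.eventually_analyticAt, H.analyticAt_E.eventually_analyticAt,
        hYc.eventually H.analyticAt_h.eventually_analyticAt] with x e h1 h2 h3 h4 h5 h6 aY aE ah
      have dY := aY.differentiableAt.hasDerivAt
      have dE := aE.differentiableAt.hasDerivAt
      have h7 : deriv Y x = E x / (1 + h (Y x)) := by
        rw [eq_div_iff h6, mul_comm, h1]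
      rw [h7] at dY
      rw [h2, ratFun] at dE
      have dP := (analyticAt_seqP ah k).differentiableAt.hasDerivAt.comp x dY
      have dh := (ah.differentiableAt.hasDerivAt.comp x dY).const_add 1
      have dL := dP.fun_div (dh.pow_of_ne_zero h6 (2 * k + 1)) (pow_ne_zero _ h6)
      have dQ := ((seqQ Nf Df Ng Dg k).hasDerivAt x).fun_mul dE
      have dW := (((Df.hasDerivAt x).pow_of_ne_zero h3 k).fun_mul
        ((Dg.hasDerivAt x).pow_of_ne_zero h4 (k + 1))).fun_mul (dE.pow_of_ne_zero h5 k)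
      have dR := dQ.fun_div dW (by positivity)
      have := EventuallyEq.deriv_eq e
      have := dL.deriv.symm.trans (this.trans dR.deriv)
      apply mul_left_cancel₀ h5
      simp only [seqP, seqQ, stepQ, eval_add, eval_sub, eval_mul, eval_C, Function.comp] at this ⊢
      generalize (1 + h (Y x)) = a at *
      generalize eval x Df = D at *
      generalize eval x Dg = G at *
      generalize E x = e at *
      refine Eq.trans ?_ (this.trans ?_)
      · push_cast
        field_simp
        ring
      · push_cast
        field_simp
        ring
  have := (key k).self_of_nhds
  simpa [H.Y_zero, H.h_zero, H.E_zero, hDf, hDg] using this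

/-! ### Polar coordinates and explicit periodic orbits. -/

/-- The time needed to reach the angle `θ` on the circle of radius `r`, for the angular speed
`1 / (1 + h(r sin θ))`. -/
def travelTime (h : ℝ → ℝ) (r θ : ℝ) : ℝ := ∫ s in (0 : ℝ)..θ, (1 + h (r * Real.sin s))

/-- The period of the orbit of radius `r`. -/
def orbitPeriod (h : ℝ → ℝ) (r : ℝ) : ℝ := travelTime h r (2 * Real.pi)

/-- Urabe's normal form on a neighbourhood `Y.source` of `0`. -/
structure UrabeChart (f g E h : ℝ → ℝ) (Y : OpenPartialHomeomorph ℝ ℝ) : Prop where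
  zero_mem : (0 : ℝ) ∈ Y.source
  Y_zero : Y 0 = 0
  hasDerivAt_E : ∀ x ∈ Y.source, HasDerivAt E (f x * E x) x
  E_pos : ∀ x ∈ Y.source, 0 < E x
  hasDerivAt_Y : ∀ x ∈ Y.source, HasDerivAt Y (deriv Y x) x
  deriv_Y_pos : ∀ x ∈ Y.source, 0 < deriv Y x
  Y_mul_deriv : ∀ x ∈ Y.source, Y x * deriv Y x = g x * E x ^ 2
  one_add_h : ∀ x ∈ Y.source, (1 + h (Y x)) * deriv Y x = E x
  continuousOn_h : ContinuousOn h Y.target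

/-- The identities of the normal form hold only near `0`; shrinking the domain of the local inverse
makes them hold throughout it, and inside `s`, where the denominators will be nonzero. -/
lemma UrabeForm.exists_chart {f g E Y h : ℝ → ℝ} (H : UrabeForm f g E Y h) {s : Set ℝ}
    (hs : s ∈ 𝓝 (0 : ℝ)) :
    ∃ e : OpenPartialHomeomorph ℝ ℝ, ⇑e = Y ∧ e.source ⊆ s ∧ UrabeChart f g E h e := by
  have hY1 : deriv Y 0 ≠ 0 := by rw [H.deriv_Y_zero]; exact one_ne_zero
  have hd : HasStrictFDerivAt Y
      ((ContinuousLinearEquiv.unitsEquivAut ℝ (Units.mk0 _ hY1) : ℝ ≃L[ℝ] ℝ) : ℝ →L[ℝ] ℝ) 0 :=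
    H.analyticAt_Y.hasStrictDerivAt
  set e₀ := hd.toOpenPartialHomeomorph Y with he₀
  have hcoe : ⇑e₀ = Y := hd.toOpenPartialHomeomorph_coe
  have h0 : (0 : ℝ) ∈ e₀.source := hd.mem_toOpenPartialHomeomorph_source
  have hYc : Tendsto Y (𝓝 0) (𝓝 0) := by simpa [H.Y_zero] using H.analyticAt_Y.continuousAt.tendsto
  have pE : ∀ᶠ x in 𝓝 (0 : ℝ), 0 < E x :=
    ContinuousAt.eventually_lt continuousAt_const H.analyticAt_E.continuousAt
      (by rw [H.E_zero]; exact one_pos)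
  have pY : ∀ᶠ x in 𝓝 (0 : ℝ), 0 < deriv Y x :=
    ContinuousAt.eventually_lt continuousAt_const H.analyticAt_Y.deriv.continuousAt
      (by rw [H.deriv_Y_zero]; exact one_pos)
  have hall : ∀ᶠ x in 𝓝 (0 : ℝ), x ∈ s ∧ deriv E x = f x * E x ∧ DifferentiableAt ℝ E x ∧
      0 < E x ∧ DifferentiableAt ℝ Y x ∧ 0 < deriv Y x ∧ Y x * deriv Y x = g x * E x ^ 2 ∧
      (1 + h (Y x)) * deriv Y x = E x ∧ ContinuousAt h (Y x) := by
    filter_upwards [hs, H.deriv_E, H.analyticAt_E.eventually_analyticAt, pE,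
      H.analyticAt_Y.eventually_analyticAt, pY, H.Y_mul_deriv, H.one_add_h,
      hYc.eventually H.analyticAt_h.eventually_analyticAt] with x h1 h2 h3 h4 h5 h6 h7 h8 h9
    exact ⟨h1, h2, h3.differentiableAt, h4, h5.differentiableAt, h6, h7, h8, h9.continuousAt⟩
  obtain ⟨t, ht, hto, ht0⟩ := eventually_nhds_iff.1 hall
  have hsrc : (e₀.restrOpen t hto).source = e₀.source ∩ t := e₀.restrOpen_source t hto
  have hcoe' : ⇑(e₀.restrOpen t hto) = Y := hcoe
  refine ⟨e₀.restrOpen t hto, hcoe', ?_, ?_⟩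
  · rw [hsrc]
    exact fun x hx => (ht x hx.2).1
  · have hmem : ∀ x ∈ (e₀.restrOpen t hto).source, x ∈ t := fun x hx => by
      rw [hsrc] at hx
      exact hx.2
    constructor
    · rw [hsrc]
      exact ⟨h0, ht0⟩
    · rw [hcoe', H.Y_zero]
    · intro x hx
      obtain ⟨-, h2, h3, -⟩ := ht x (hmem x hx)
      rw [← h2]
      exact h3.hasDerivAt
    · exact fun x hx => (ht x (hmem x hx)).2.2.2.1
    · intro x hx
      rw [hcoe']
      exact (ht x (hmem x hx)).2.2.2.2.1.hasDerivAt
    · intro x hx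
      rw [hcoe']
      exact (ht x (hmem x hx)).2.2.2.2.2.1
    · intro x hx
      rw [hcoe']
      exact (ht x (hmem x hx)).2.2.2.2.2.2.1
    · intro x hx
      rw [hcoe']
      exact (ht x (hmem x hx)).2.2.2.2.2.2.2.1
    · intro ξ hξ
      obtain ⟨x, hx, rfl⟩ : ∃ x ∈ (e₀.restrOpen t hto).source, (e₀.restrOpen t hto) x = ξ :=
        ⟨_, OpenPartialHomeomorph.map_target _ hξ, OpenPartialHomeomorph.right_inv _ hξ⟩
      rw [hcoe']
      exact (ht x (hmem x hx)).2.2.2.2.2.2.2.2.continuousWithinAt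

section Rotation

variable {h : ℝ → ℝ} {r : ℝ}

lemma hasDerivAt_travelTime (hc : Continuous fun s => h (r * Real.sin s)) (θ : ℝ) :
    HasDerivAt (travelTime h r) (1 + h (r * Real.sin θ)) θ :=
  (continuous_const.add hc).integral_hasStrictDerivAt 0 θ |>.hasDerivAt

lemma travelTime_add_two_pi (hc : Continuous fun s => h (r * Real.sin s))
    (θ : ℝ) :
    travelTime h r (θ + 2 * Real.pi) = travelTime h r θ + orbitPeriod h r := by
  have hp : Function.Periodic (fun s => 1 + h (r * Real.sin s)) (2 * Real.pi) := fun s => by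
    simp only [Real.sin_add_two_pi]
  have := hp.intervalIntegral_add_eq_add 0 θ fun _ _ =>
    (continuous_const.add hc).intervalIntegrable _ _
  rw [zero_add] at this
  exact this

lemma strictMono_travelTime (hc : Continuous fun s => h (r * Real.sin s))
    (hpos : ∀ s, 0 < 1 + h (r * Real.sin s)) : StrictMono (travelTime h r) :=
  strictMono_of_hasDerivAt_pos (fun θ => hasDerivAt_travelTime hc θ) hpos

/-- The travel time is strictly increasing and, its integrand being positive and periodic, unbounded
both ways; its inverse `Θ` is the angle as a function of time. -/
lemma exists_angle (hc : Continuous fun s => h (r * Real.sin s))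
    (hpos : ∀ s, 0 < 1 + h (r * Real.sin s)) :
    ∃ Θ : ℝ → ℝ, (∀ θ, Θ (travelTime h r θ) = θ) ∧ StrictMono Θ ∧
    (∀ t, HasDerivAt Θ (1 + h (r * Real.sin (Θ t)))⁻¹ t) ∧
    ∀ t, Θ (t + orbitPeriod h r) = Θ t + 2 * Real.pi := by
  have hp : Function.Periodic (fun s => 1 + h (r * Real.sin s)) (2 * Real.pi) := fun s => by
    simp only [Real.sin_add_two_pi]
  have hint := (continuous_const.add hc : Continuous fun s => 1 + h (r * Real.sin s))
    |>.intervalIntegrable (μ := MeasureTheory.volume) 0 (2 * Real.pi)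
  have hmono := strictMono_travelTime hc hpos
  have hcont : Continuous (travelTime h r) :=
    continuous_iff_continuousAt.2 fun θ => (hasDerivAt_travelTime hc θ).continuousAt
  have hsurj : Function.Surjective (travelTime h r) := hcont.surjective
    (hp.tendsto_atTop_intervalIntegral_of_pos' hint hpos Real.two_pi_pos)
    (hp.tendsto_atBot_intervalIntegral_of_pos' hint hpos Real.two_pi_pos)
  let e := hmono.orderIsoOfSurjective _ hsurj
  have he : ∀ θ, e θ = travelTime h r θ := fun θ => rfl
  have hl : ∀ θ, e.symm (travelTime h r θ) = θ := fun θ => by rw [← he, e.symm_apply_apply]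
  have hr : ∀ t, travelTime h r (e.symm t) = t := fun t => by rw [← he, e.apply_symm_apply]
  refine ⟨e.symm, hl, e.symm.strictMono, fun t => ?_, fun t => ?_⟩
  · exact HasDerivAt.of_local_left_inverse e.symm.continuous.continuousAt
      (hasDerivAt_travelTime hc _) (hpos _).ne' (Eventually.of_forall hr)
  · rw [← hl (e.symm t + 2 * Real.pi), travelTime_add_two_pi hc, hr]

lemma orbitPeriod_pos (hc : Continuous fun s => h (r * Real.sin s))
    (hpos : ∀ s, 0 < 1 + h (r * Real.sin s)) : 0 < orbitPeriod h r := by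
  have := strictMono_travelTime hc hpos Real.two_pi_pos
  simpa [travelTime, orbitPeriod] using this

end Rotation

namespace UrabeChart

variable {f g E h : ℝ → ℝ} {Y : OpenPartialHomeomorph ℝ ℝ}

/-- The squared radius in the coordinates `(Y(x), E(x) y)`. -/
def sqRadius (E Y : ℝ → ℝ) (p : ℝ × ℝ) : ℝ := Y p.1 ^ 2 + (E p.1 * p.2) ^ 2

/-- The disc of radius `ρ` in the coordinates `(Y(x), E(x) y)`. -/
def disc (E : ℝ → ℝ) (Y : OpenPartialHomeomorph ℝ ℝ) (ρ : ℝ) : Set (ℝ × ℝ) :=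
  {p | p.1 ∈ Y.source ∧ sqRadius E Y p < ρ ^ 2}

lemma isOpen_disc (H : UrabeChart f g E h Y) (ρ : ℝ) : IsOpen (disc E Y ρ) := by
  have hE : ContinuousOn E Y.source := fun x hx =>
    (H.hasDerivAt_E x hx).continuousAt.continuousWithinAt
  have hfst : Set.MapsTo Prod.fst (Y.source ×ˢ (Set.univ : Set ℝ)) Y.source := fun p hp => hp.1
  have hc : ContinuousOn (sqRadius E Y) (Y.source ×ˢ (Set.univ : Set ℝ)) :=
    ((Y.continuousOn.comp continuousOn_fst hfst).pow 2).add
      (((hE.comp continuousOn_fst hfst).mul continuousOn_snd).pow 2)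
  have := hc.isOpen_inter_preimage (Y.open_source.prod isOpen_univ) (isOpen_Iio (a := ρ ^ 2))
  convert this using 1
  ext p
  simp [disc]

lemma zero_mem_disc (H : UrabeChart f g E h Y) {ρ : ℝ} (hρ : 0 < ρ) : (0 : ℝ × ℝ) ∈ disc E Y ρ := by
  refine ⟨H.zero_mem, ?_⟩
  simp [sqRadius, H.Y_zero, hρ]

lemma one_add_h_pos (H : UrabeChart f g E h Y) {ξ : ℝ} (hξ : ξ ∈ Y.target) : 0 < 1 + h ξ := by
  have hx := Y.map_target hξ
  have := H.one_add_h _ hx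
  rw [Y.right_inv hξ] at this
  have h1 := H.E_pos _ hx
  rw [← this] at h1
  exact pos_of_mul_pos_left h1 (H.deriv_Y_pos _ hx).le

/-- Every point of a small punctured disc lies on a periodic orbit in that disc. -/
lemma exists_isPeriodicSolution (H : UrabeChart f g E h Y) {ρ : ℝ} (hρ : 0 < ρ)
    (htarget : Set.Ioo (-ρ) ρ ⊆ Y.target) {p : ℝ × ℝ} (hp : p ∈ disc E Y ρ) (hp0 : p ≠ 0) :
    ∃ γ : ℝ → ℝ × ℝ, γ 0 = p ∧ IsPeriodicSolution (lienardField f g) (disc E Y ρ) γ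
      (orbitPeriod h (√(sqRadius E Y p))) := by
  obtain ⟨hps, hpρ⟩ := hp
  set r := √(sqRadius E Y p) with hr
  have hnn : 0 ≤ sqRadius E Y p := by unfold sqRadius; positivity
  have hr2 : r ^ 2 = sqRadius E Y p := Real.sq_sqrt hnn
  have hr0 : 0 < r := by
    refine Real.sqrt_pos.2 (hnn.lt_of_ne' fun h0 => hp0 ?_)
    have h1 : Y p.1 = 0 := by
      unfold sqRadius at h0
      nlinarith [sq_nonneg (Y p.1), sq_nonneg (E p.1 * p.2)]
    have h2 : E p.1 * p.2 = 0 := by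
      unfold sqRadius at h0
      nlinarith [sq_nonneg (Y p.1), sq_nonneg (E p.1 * p.2)]
    refine Prod.ext ?_ ((mul_eq_zero.1 h2).resolve_left (H.E_pos _ hps).ne')
    exact Y.injOn hps H.zero_mem (h1.trans H.Y_zero.symm)
  have hrρ : r < ρ := by
    rw [← hr2] at hpρ
    exact lt_of_pow_lt_pow_left₀ 2 hρ.le hpρ
  have hmem : ∀ s, r * Real.sin s ∈ Y.target := fun s => by
    apply htarget
    have h1 := Real.neg_one_le_sin s
    have h2 := Real.sin_le_one s
    constructor <;> nlinarith
  have hpos : ∀ s, 0 < 1 + h (r * Real.sin s) := fun s => H.one_add_h_pos (hmem s)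
  have hc : Continuous fun s => h (r * Real.sin s) :=
    H.continuousOn_h.comp_continuous (continuous_const.mul Real.continuous_sin) hmem
  obtain ⟨Θ, hΘl, hΘmono, hΘd, hΘp⟩ := exists_angle hc hpos
  -- The initial angle is the argument of the complex number `E y + i Y`; the shift `t₀` below
  -- places it at time `0`.
  obtain ⟨α, hα1, hα2⟩ : ∃ α, r * Real.sin α = Y p.1 ∧ r * Real.cos α = E p.1 * p.2 := by
    have hn : ‖(⟨E p.1 * p.2, Y p.1⟩ : ℂ)‖ = r := by
      rw [hr, Complex.norm_def, Complex.normSq_mk, sqRadius]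
      congr 1
      ring
    refine ⟨Complex.arg ⟨E p.1 * p.2, Y p.1⟩, ?_, ?_⟩
    · have := Complex.norm_mul_sin_arg ⟨E p.1 * p.2, Y p.1⟩
      rwa [hn] at this
    · have := Complex.norm_mul_cos_arg ⟨E p.1 * p.2, Y p.1⟩
      rwa [hn] at this
  set t₀ := travelTime h r α with ht₀
  set x : ℝ → ℝ := fun t => Y.symm (r * Real.sin (Θ (t + t₀))) with hx
  set y : ℝ → ℝ := fun t => r * Real.cos (Θ (t + t₀)) / E (x t) with hy
  have hxs : ∀ t, x t ∈ Y.source := fun t => Y.map_target (hmem _)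
  have hYx : ∀ t, Y (x t) = r * Real.sin (Θ (t + t₀)) := fun t => Y.right_inv (hmem _)
  have hEy : ∀ t, E (x t) * y t = r * Real.cos (Θ (t + t₀)) := fun t =>
    mul_div_cancel₀ _ (H.E_pos _ (hxs t)).ne'
  have hcongr : ∀ t t', Real.sin (Θ (t + t₀)) = Real.sin (Θ (t' + t₀)) →
      Real.cos (Θ (t + t₀)) = Real.cos (Θ (t' + t₀)) → (x t, y t) = (x t', y t') := by
    intro t t' h1 h2
    simp only [hy, hx, h1, h2]
  have hdx : ∀ t, HasDerivAt x (y t) t := by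
    intro t
    have hd := ((hΘd (t + t₀)).comp_add_const t t₀).sin.const_mul r
    have h1 := Y.hasDerivAt_symm (hmem (Θ (t + t₀))) (H.deriv_Y_pos _ (hxs t)).ne'
      (H.hasDerivAt_Y _ (hxs t))
    refine (h1.comp t hd).congr_deriv ?_
    have h2 := H.one_add_h _ (hxs t)
    have h3 := (H.deriv_Y_pos _ (hxs t)).ne'
    have h4 := (hpos (Θ (t + t₀))).ne'
    rw [hYx] at h2
    simp only [hy]
    rw [← h2]
    field_simp
  have hdy : ∀ t, HasDerivAt y (-g (x t) - f (x t) * y t ^ 2) t := by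
    intro t
    have hd := ((hΘd (t + t₀)).comp_add_const t t₀).cos.const_mul r
    have hdE := (H.hasDerivAt_E _ (hxs t)).comp t (hdx t)
    have hE0 := (H.E_pos _ (hxs t)).ne'
    refine (hd.fun_div hdE hE0).congr_deriv ?_
    have h2 := H.one_add_h _ (hxs t)
    have h3 := (H.deriv_Y_pos _ (hxs t)).ne'
    have h4 := (hpos (Θ (t + t₀))).ne'
    have h5 := H.Y_mul_deriv _ (hxs t)
    rw [hYx] at h2 h5
    have h6 : (1 + h (r * Real.sin (Θ (t + t₀))))⁻¹ = deriv Y (x t) / E (x t) := by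
      rw [← h2]
      field_simp
    have h7 := hEy t
    simp only [Function.comp]
    rw [h6, ← h7]
    field_simp
    linear_combination (-1 : ℝ) * h5
  refine ⟨fun t => (x t, y t), ?_, ?_⟩
  · have hΘ0 : Θ (0 + t₀) = α := by rw [zero_add, hΘl]
    have hx0 : x 0 = p.1 := by
      simp only [hx, hΘ0, hα1]
      exact Y.left_inv hps
    refine Prod.ext hx0 ?_
    simp only [hy, hx0, hΘ0, hα2]
    rw [mul_div_cancel_left₀ _ (H.E_pos _ hps).ne']
  · constructor
    · intro t
      refine ⟨hxs t, ?_⟩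
      have : sqRadius E Y (x t, y t) = r ^ 2 := by
        simp only [sqRadius, hYx, hEy]
        linear_combination r ^ 2 * Real.sin_sq_add_cos_sq (Θ (t + t₀))
      rw [this, hr2]
      exact hpρ
    · exact fun t => (hdx t).prodMk (hdy t)
    · exact orbitPeriod_pos hc hpos
    · intro t
      have : Θ (t + orbitPeriod h r + t₀) = Θ (t + t₀) + 2 * Real.pi := by
        rw [← hΘp]
        congr 1
        ring
      exact hcongr _ _ (by rw [this, Real.sin_add_two_pi]) (by rw [this, Real.cos_add_two_pi])
    · intro s hs hsT hper
      have h1 := hper 0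
      rw [zero_add] at h1
      have hx1 : x s = x 0 := congrArg Prod.fst h1
      have hy1 : y s = y 0 := congrArg Prod.snd h1
      have hsin : Real.sin (Θ (s + t₀)) = Real.sin (Θ (0 + t₀)) := by
        have := hYx s
        rw [hx1, hYx 0] at this
        exact (mul_left_cancel₀ hr0.ne' this).symm
      have hcos : Real.cos (Θ (s + t₀)) = Real.cos (Θ (0 + t₀)) := by
        have := hEy s
        rw [hx1, hy1, hEy 0] at this
        exact (mul_left_cancel₀ hr0.ne' this).symm
      -- An earlier return would make the angle increase by a multiple of `2π` lying strictly
      -- between `0` and `2π`.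
      obtain ⟨n, hn⟩ := Real.Angle.angle_eq_iff_two_pi_dvd_sub.1
        (Real.Angle.cos_sin_inj hcos hsin)
      have l1 : Θ (0 + t₀) < Θ (s + t₀) := hΘmono (by linarith)
      have l2 : Θ (s + t₀) < Θ (0 + t₀) + 2 * Real.pi := by
        rw [← hΘp]
        exact hΘmono (by linarith)
      have hpi := Real.two_pi_pos
      have n1 : (0 : ℝ) < n := by
        by_contra hcon
        nlinarith
      have n2 : (n : ℝ) < 1 := by
        by_contra hcon
        nlinarith
      have n1' : 0 < n := by exact_mod_cast n1
      have n2' : n < 1 := by exact_mod_cast n2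
      omega

end UrabeChart

/-! ### Constant period and oddness of `h`. -/

/-- Since `sin (s + π) = -sin s`, the second half turn folds onto the first, and only the even part
of `h` contributes. -/
lemma orbitPeriod_eq {h : ℝ → ℝ} {r : ℝ} (hc : Continuous fun s => h (r * Real.sin s)) :
    orbitPeriod h r = 2 * Real.pi +
      ∫ s in (0 : ℝ)..Real.pi, (h (r * Real.sin s) + h (-(r * Real.sin s))) := by
  have hshift : ∀ s, h (r * Real.sin (s + Real.pi)) = h (-(r * Real.sin s)) := fun s => by
    rw [Real.sin_add_pi, mul_neg]
  have hc' : Continuous fun s => h (-(r * Real.sin s)) := by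
    simp only [← hshift]
    exact hc.comp (continuous_id.add continuous_const)
  have h1 : ∫ s in (0 : ℝ)..Real.pi, h (-(r * Real.sin s)) =
      ∫ s in Real.pi..(2 * Real.pi), h (r * Real.sin s) := by
    simp only [← hshift]
    rw [intervalIntegral.integral_comp_add_right (fun s => h (r * Real.sin s))]
    congr 1 <;> ring
  rw [intervalIntegral.integral_add (hc.intervalIntegrable _ _) (hc'.intervalIntegrable _ _), h1,
    intervalIntegral.integral_add_adjacent_intervals (hc.intervalIntegrable _ _)
      (hc.intervalIntegrable _ _), orbitPeriod, travelTime,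
    intervalIntegral.integral_add (continuous_const.intervalIntegrable _ _)
      (hc.intervalIntegrable _ _)]
  simp

lemma mul_sin_mem_Ioo {r δ : ℝ} (hr : 0 ≤ r) (hrδ : r < δ) (s : ℝ) :
    r * Real.sin s ∈ Set.Ioo (-δ) δ := by
  have h1 := Real.neg_one_le_sin s
  have h2 := Real.sin_le_one s
  constructor <;> nlinarith

lemma continuous_comp_mul_sin {h : ℝ → ℝ} {r δ : ℝ} (hc : ContinuousOn h (Set.Ioo (-δ) δ))
    (hr : 0 ≤ r) (hrδ : r < δ) : Continuous fun s => h (r * Real.sin s) :=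
  hc.comp_continuous (continuous_const.mul Real.continuous_sin) (mul_sin_mem_Ioo hr hrδ)

lemma integral_comp_mul_sin_pos {k : ℝ → ℝ} {r δ : ℝ} (hc : ContinuousOn k (Set.Ioo (-δ) δ))
    (hr : 0 < r) (hrδ : r < δ) (hk : ∀ x ∈ Set.Ioo 0 δ, 0 < k x) :
    0 < ∫ s in (0 : ℝ)..Real.pi, k (r * Real.sin s) := by
  refine intervalIntegral.intervalIntegral_pos_of_pos_on
    ((continuous_comp_mul_sin hc hr.le hrδ).intervalIntegrable _ _) (fun s hs => ?_) Real.pi_pos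
  exact hk _ ⟨mul_pos hr (Real.sin_pos_of_mem_Ioo hs), (mul_sin_mem_Ioo hr.le hrδ s).2⟩

lemma AnalyticAt.comp_neg_zero {h : ℝ → ℝ} (hh : AnalyticAt ℝ h 0) :
    AnalyticAt ℝ (fun x => h (-x)) 0 := by
  have hh' : AnalyticAt ℝ h (-(0 : ℝ)) := by rwa [neg_zero]
  exact hh'.comp (f := fun x : ℝ => -x) analyticAt_id.neg

lemma exists_Ioo_of_eventually {p : ℝ → Prop} (hp : ∀ᶠ x in 𝓝 (0 : ℝ), p x) :
    ∃ δ > 0, ∀ x ∈ Set.Ioo (-δ) δ, p x := by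
  obtain ⟨δ, hδ, h⟩ := Metric.eventually_nhds_iff_ball.1 hp
  refine ⟨δ, hδ, fun x hx => h x ?_⟩
  rwa [Real.ball_eq_Ioo, zero_sub, zero_add]

/-- If all orbits of small radius have the same period, then `h` is odd. -/
lemma isOddAnalytic_of_orbitPeriod_eq {h : ℝ → ℝ} (hh : AnalyticAt ℝ h 0) (h0 : h 0 = 0) {T : ℝ}
    (hT : ∀ᶠ r in 𝓝 (0 : ℝ), 0 < r → orbitPeriod h r = T) : IsOddAnalytic h := by
  refine ⟨hh, ?_⟩
  set k : ℝ → ℝ := fun x => h x + h (-x) with hk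
  have hka : AnalyticAt ℝ k 0 := hh.add hh.comp_neg_zero
  -- Zeros of an analytic function are isolated: unless `k` vanishes near `0`, it has constant sign
  -- on some `(0, δ)`, and then its integral cannot be zero.
  rcases hka.eventually_eq_zero_or_eventually_ne_zero with hz | hnz
  · filter_upwards [hz] with x hx
    exact eq_neg_of_add_eq_zero_right hx
  exfalso
  obtain ⟨δ, hδ, hall⟩ := exists_Ioo_of_eventually
    ((eventually_nhdsWithin_iff.1 hnz).and (hT.and hh.eventually_analyticAt))
  have hcont : ContinuousOn h (Set.Ioo (-δ) δ) := fun x hx =>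
    (hall x hx).2.2.continuousAt.continuousWithinAt
  have hcontk : ContinuousOn k (Set.Ioo (-δ) δ) := hcont.add
    (hcont.comp continuousOn_neg fun x hx => ⟨neg_lt_neg hx.2, by linarith [hx.1]⟩)
  have hper : ∀ r, 0 < r → r < δ →
      ∫ s in (0 : ℝ)..Real.pi, k (r * Real.sin s) = T - 2 * Real.pi := by
    intro r hr hrδ
    rw [← (hall r ⟨by linarith, hrδ⟩).2.1 hr,
      orbitPeriod_eq (continuous_comp_mul_sin hcont hr.le hrδ)]
    ring
  -- Letting `r` tend to `0`: as `k(0) = 0`, the integral can be bounded by half of `|T - 2π|`,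
  -- while it equals `T - 2π`.
  have hT2 : T - 2 * Real.pi = 0 := by
    by_contra hne
    have hε : 0 < |T - 2 * Real.pi| / (2 * Real.pi) := by
      have := abs_pos.2 hne
      positivity
    have hsmall : ∀ᶠ x in 𝓝 (0 : ℝ), |k x| < |T - 2 * Real.pi| / (2 * Real.pi) :=
      ContinuousAt.eventually_lt hka.continuousAt.abs continuousAt_const (by simpa [hk, h0] using hε)
    obtain ⟨η, hη, hsm⟩ := exists_Ioo_of_eventually hsmall
    have hm : 0 < min δ η := lt_min hδ hη
    have hr0 : 0 < min δ η / 2 := by positivity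
    have hr1 : min δ η / 2 < δ := by linarith [min_le_left δ η]
    have hr2 : min δ η / 2 < η := by linarith [min_le_right δ η]
    have := intervalIntegral.norm_integral_le_of_norm_le_const (a := 0) (b := Real.pi)
      (f := fun s => k (min δ η / 2 * Real.sin s)) (C := |T - 2 * Real.pi| / (2 * Real.pi))
      fun s _ => (hsm _ (mul_sin_mem_Ioo hr0.le hr2 s)).le
    rw [hper _ hr0 hr1, sub_zero, abs_of_pos Real.pi_pos, Real.norm_eq_abs] at this
    have h3 : |T - 2 * Real.pi| / (2 * Real.pi) * Real.pi = |T - 2 * Real.pi| / 2 := by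
      field_simp
    rw [h3] at this
    linarith [abs_pos.2 hne]
  have hr0 : 0 < δ / 2 := by positivity
  have hr1 : δ / 2 < δ := by linarith
  have hzero := hper _ hr0 hr1
  rw [hT2] at hzero
  have hne : ∀ x ∈ Set.Ioo 0 δ, k x ≠ 0 := fun x hx =>
    (hall x ⟨by linarith [hx.1], hx.2⟩).1 hx.1.ne'
  have hsub : Set.Ioo 0 δ ⊆ Set.Ioo (-δ) δ := Set.Ioo_subset_Ioo_left (by linarith)
  have hsign : (∀ x ∈ Set.Ioo 0 δ, 0 < k x) ∨ ∀ x ∈ Set.Ioo 0 δ, 0 < -k x := by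
    by_contra! hcon
    obtain ⟨⟨a, ha, hka⟩, b, hb, hkb⟩ := hcon
    obtain ⟨c, hc, hkc⟩ := isPreconnected_Ioo.intermediate_value ha hb (hcontk.mono hsub)
      ⟨hka, by linarith⟩
    exact hne c hc hkc
  rcases hsign with hs | hs
  · exact (integral_comp_mul_sin_pos hcontk hr0 hr1 hs).ne' hzero
  · have := integral_comp_mul_sin_pos (k := fun x => -k x) hcontk.neg hr0 hr1 hs
    rw [intervalIntegral.integral_neg, hzero] at this
    linarith

lemma taylorSeries_add_comp_neg {h : ℝ → ℝ} (hh : AnalyticAt ℝ h 0) (i : ℕ) :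
    PowerSeries.coeff i (taylorSeries fun x => h x + h (-x)) =
      (1 + (-1) ^ i) * PowerSeries.coeff i (taylorSeries h) := by
  rw [taylorSeries_add hh hh.comp_neg_zero, map_add, coeff_taylorSeries, coeff_taylorSeries,
    iteratedDeriv_comp_neg, neg_zero, smul_eq_mul]
  ring

lemma isOddAnalytic_iff {h : ℝ → ℝ} (hh : AnalyticAt ℝ h 0) :
    IsOddAnalytic h ↔ ∀ j, PowerSeries.coeff (2 * j) (taylorSeries h) = 0 := by
  constructor
  · intro ho j
    have e : (fun x => h x + h (-x)) =ᶠ[𝓝 0] fun _ => 0 := by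
      filter_upwards [ho.2] with x hx
      rw [hx, add_neg_cancel]
    have := taylorSeries_add_comp_neg hh (2 * j)
    rw [taylorSeries_congr e, taylorSeries_const, map_zero, map_zero, pow_mul] at this
    norm_num at this
    exact this
  · intro hj
    refine ⟨hh, ?_⟩
    have := AnalyticAt.eventually_eq_zero_of_taylorSeries (hh.add hh.comp_neg_zero) (by
      ext i
      refine (taylorSeries_add_comp_neg hh i).trans ?_
      rw [map_zero]
      rcases Nat.even_or_odd' i with ⟨j, rfl | rfl⟩
      · rw [hj, mul_zero]
      · rw [pow_succ, pow_mul]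
        norm_num)
    filter_upwards [this] with x hx
    exact eq_neg_of_add_eq_zero_right hx

/-! ### Uniqueness of orbits and the criterion for isochronicity. -/

/-- Solutions of a `C¹` vector field contained in its domain are determined by a value. -/
lemma eq_of_hasDerivAt_of_contDiffAt {F : Type*} [NormedAddCommGroup F] [NormedSpace ℝ F]
    {X : F → F} {U : Set F} (hX : ∀ p ∈ U, ContDiffAt ℝ 1 X p) {γ₁ γ₂ : ℝ → F}
    (h₁ : ∀ t, HasDerivAt γ₁ (X (γ₁ t)) t) (h₂ : ∀ t, HasDerivAt γ₂ (X (γ₂ t)) t)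
    (hU : ∀ t, γ₁ t ∈ U) (h0 : γ₁ 0 = γ₂ 0) : γ₁ = γ₂ := by
  have c₁ : Continuous γ₁ := continuous_iff_continuousAt.2 fun t => (h₁ t).continuousAt
  have c₂ : Continuous γ₂ := continuous_iff_continuousAt.2 fun t => (h₂ t).continuousAt
  -- Local uniqueness makes the coincidence set open; `ℝ` is connected.
  have hclopen : IsClopen {t | γ₁ t = γ₂ t} := by
    refine ⟨isClosed_eq c₁ c₂, isOpen_iff_mem_nhds.2 fun t (ht : γ₁ t = γ₂ t) => ?_⟩
    obtain ⟨K, s, hs, hK⟩ := (hX _ (hU t)).exists_lipschitzOnWith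
    have hs' := hs
    rw [ht] at hs'
    refine ODE_solution_unique_of_eventually (v := fun _ => X) (s := fun _ => s) (K := K)
      (Eventually.of_forall fun _ => hK) ?_ ?_ ht
    · filter_upwards [c₁.continuousAt.eventually_mem hs] with τ hτ using ⟨h₁ τ, hτ⟩
    · filter_upwards [c₂.continuousAt.eventually_mem hs'] with τ hτ using ⟨h₂ τ, hτ⟩
  have huniv := hclopen.eq_univ ⟨0, h0⟩
  funext t
  have : t ∈ {t | γ₁ t = γ₂ t} := by
    rw [huniv]
    trivial
  exact this

lemma IsPeriodicSolution.period_unique {X : ℝ × ℝ → ℝ × ℝ} {V V' : Set (ℝ × ℝ)}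
    {γ : ℝ → ℝ × ℝ} {T T' : ℝ} (h : IsPeriodicSolution X V γ T)
    (h' : IsPeriodicSolution X V' γ T') : T = T' := by
  rcases lt_trichotomy T T' with hlt | heq | hlt
  · exact absurd h.periodic (h'.minimal T h.pos hlt)
  · exact heq
  · exact absurd h'.periodic (h.minimal T' h'.pos hlt)

lemma contDiffAt_lienardField {Nf Df Ng Dg : ℝ[X]} {p : ℝ × ℝ} (hp : p ∈ ratDomain Df Dg) :
    ContDiffAt ℝ 1 (lienardField (ratFun Nf Df) (ratFun Ng Dg)) p := by
  have hP : ∀ P : ℝ[X], ContDiffAt ℝ 1 (fun q : ℝ × ℝ => P.eval q.1) p := fun P =>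
    (AnalyticOnNhd.eval_polynomial P p.1 (Set.mem_univ _)).contDiffAt.comp p contDiffAt_fst
  have hf := (hP Nf).div (hP Df) hp.1
  have hg := (hP Ng).div (hP Dg) hp.2
  exact contDiffAt_snd.prodMk (hg.neg.sub (hf.mul (contDiffAt_snd.pow 2)))

lemma analyticAt_ratFun {N D : ℝ[X]} {x : ℝ} (hD : D.eval x ≠ 0) : AnalyticAt ℝ (ratFun N D) x :=
  (AnalyticOnNhd.eval_polynomial N x (Set.mem_univ x)).div
    (AnalyticOnNhd.eval_polynomial D x (Set.mem_univ x)) hD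

/-- The coordinate disc of a chart of Urabe's normal form witnesses an isochronous center exactly
when `h` is odd. -/
lemma isIsochronousCenter_iff {Nf Df Ng Dg : ℝ[X]} {E Y h : ℝ → ℝ}
    (H : UrabeForm (ratFun Nf Df) (ratFun Ng Dg) E Y h) (hDf : Df.eval 0 = 1)
    (hDg : Dg.eval 0 = 1) (hg : ratFun Ng Dg 0 = 0) :
    IsIsochronousCenter (ratDomain Df Dg) (lienardField (ratFun Nf Df) (ratFun Ng Dg)) 0 ↔
      IsOddAnalytic h := by
  have nDf : ∀ᶠ x in 𝓝 (0 : ℝ), Df.eval x ≠ 0 :=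
    Df.continuous.continuousAt.eventually_ne (by rw [hDf]; exact one_ne_zero)
  have nDg : ∀ᶠ x in 𝓝 (0 : ℝ), Dg.eval x ≠ 0 :=
    Dg.continuous.continuousAt.eventually_ne (by rw [hDg]; exact one_ne_zero)
  obtain ⟨e, he, hes, Hc⟩ := H.exists_chart (nDf.and nDg)
  have htn : e.target ∈ 𝓝 (0 : ℝ) := by
    refine e.open_target.mem_nhds ?_
    rw [← Hc.Y_zero]
    exact e.map_source Hc.zero_mem
  constructor
  · rintro ⟨-, T, V, hVo, hV0, hVU, hV⟩
    obtain ⟨ρ, hρ, hρt⟩ := exists_Ioo_of_eventually htn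
    refine isOddAnalytic_of_orbitPeriod_eq H.analyticAt_h H.h_zero (T := T) ?_
    -- Since `Y(0) = 0` and `E(0) = 1`, the point `(0, r)` lies on the circle of radius `r`;
    -- uniqueness identifies its given orbit with the explicit one, so `orbitPeriod h r = T`.
    have hpath : ContinuousAt (fun r : ℝ => ((0 : ℝ), r)) 0 := by fun_prop
    filter_upwards [hpath.eventually_mem (hVo.mem_nhds hV0), Iio_mem_nhds hρ] with r hrV hrρ hr
    have hne : ((0 : ℝ), r) ≠ 0 := fun h0 => hr.ne' (congrArg Prod.snd h0)
    have hsq : UrabeChart.sqRadius E e (0, r) = r ^ 2 := by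
      simp [UrabeChart.sqRadius, Hc.Y_zero, H.E_zero]
    have hdisc : ((0 : ℝ), r) ∈ UrabeChart.disc E e ρ := by
      refine ⟨Hc.zero_mem, ?_⟩
      rw [hsq]
      exact pow_lt_pow_left₀ hrρ hr.le two_ne_zero
    obtain ⟨γ, hγ0, hγ⟩ := Hc.exists_isPeriodicSolution hρ hρt hdisc hne
    obtain ⟨γ', hγ0', hγ'⟩ := hV _ hrV hne
    have : γ' = γ := eq_of_hasDerivAt_of_contDiffAt (fun p hp => contDiffAt_lienardField hp)
      hγ'.hasDerivAt hγ.hasDerivAt (fun t => hVU (hγ'.mem t)) (hγ0'.trans hγ0.symm)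
    subst this
    rw [hsq, Real.sqrt_sq hr.le] at hγ
    exact hγ.period_unique hγ'
  · intro ho
    obtain ⟨ρ, hρ, hall⟩ := exists_Ioo_of_eventually (Filter.Eventually.and htn ho.2)
    have hρt : Set.Ioo (-ρ) ρ ⊆ e.target := fun x hx => (hall x hx).1
    refine ⟨by simp [lienardField, hg], 2 * Real.pi, UrabeChart.disc E e ρ, Hc.isOpen_disc ρ,
      Hc.zero_mem_disc hρ, fun p hp => hes hp.1, fun p hp hp0 => ?_⟩
    obtain ⟨γ, hγ0, hγ⟩ := Hc.exists_isPeriodicSolution hρ hρt hp hp0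
    refine ⟨γ, hγ0, ?_⟩
    have hr : √(UrabeChart.sqRadius E e p) < ρ := (Real.sqrt_lt' hρ).2 hp.2
    have hr0 := Real.sqrt_nonneg (UrabeChart.sqRadius E e p)
    rw [orbitPeriod_eq (continuous_comp_mul_sin (Hc.continuousOn_h.mono hρt) hr0 hr)] at hγ
    have hz : ∀ s, h (√(UrabeChart.sqRadius E e p) * Real.sin s) +
        h (-(√(UrabeChart.sqRadius E e p) * Real.sin s)) = 0 := fun s => by
      rw [(hall _ (mul_sin_mem_Ioo hr0 hr s)).2, add_neg_cancel]
    simpa only [hz, intervalIntegral.integral_zero, add_zero] using hγ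

end

/-! ### Conclusion. -/

theorem theorem3 (d : ℕ) :
    (∃ M₀ : ℕ, 0 < M₀ ∧
      ∀ Nf Df Ng Dg : ℝ[X],
        Nf.natDegree ≤ d → Df.natDegree ≤ d → Ng.natDegree ≤ d → Dg.natDegree ≤ d →
        Df.eval 0 = 1 → Dg.eval 0 = 1 →
        ratFun Ng Dg 0 = 0 → deriv (ratFun Ng Dg) 0 = 1 →
        ∀ M : ℕ, M₀ ≤ M →
          (IsIsochronousCenter (ratDomain Df Dg)
              (lienardField (ratFun Nf Df) (ratFun Ng Dg)) 0 ↔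
            ∃ h : ℝ → ℝ, IsOddAnalytic h ∧
              ∀ k : ℕ, k ≤ M → seqP h k 0 = (seqQ Nf Df Ng Dg k).eval 0)) ∧
    (∀ (M k : ℕ), k ≤ M →
      (∀ h : ℝ → ℝ, AnalyticAt ℝ h 0 →
        truncSeqP h M k = taylorPoly (M - k) (seqP h k) ∧
        (truncSeqP h M k).eval 0 = seqP h k 0) ∧
      (∀ Nf Df Ng Dg : ℝ[X],
        truncSeqQ Nf Df Ng Dg M k = truncDeg (M - k) (seqQ Nf Df Ng Dg k) ∧
        (truncSeqQ Nf Df Ng Dg M k).eval 0 = (seqQ Nf Df Ng Dg k).eval 0)) := by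
  refine ⟨?_, fun M k hk => ⟨fun h hh => ⟨truncSeqP_eq hh hk, truncSeqP_eval_zero hh hk⟩,
    fun Nf Df Ng Dg => ⟨truncSeqQ_eq Nf Df Ng Dg hk, truncSeqQ_eval_zero Nf Df Ng Dg hk⟩⟩⟩
  obtain ⟨M₀, hM₀, hbound⟩ := exists_bound_even_coeff d
  refine ⟨M₀, hM₀, fun Nf Df Ng Dg h1 h2 h3 h4 hDf hDg hg0 hg1 M hM => ?_⟩
  obtain ⟨E, Y, h, H⟩ := exists_urabeForm
    (analyticAt_ratFun (N := Nf) (by rw [hDf]; exact one_ne_zero))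
    (analyticAt_ratFun (by rw [hDg]; exact one_ne_zero)) hg0 hg1
  have hPQ := seqP_zero_eq_seqQ_eval H hDf hDg
  rw [isIsochronousCenter_iff H hDf hDg hg0]
  refine ⟨fun ho => ⟨h, ho, fun k _ => hPQ k⟩, ?_⟩
  rintro ⟨h', ho', hPQ'⟩
  obtain ⟨a, a0, haQ, ha⟩ := hbound Nf Df Ng Dg h1 h2 h3 h4
  have hT0 : PowerSeries.constantCoeff (taylorSeries h) = 0 := by
    rw [constantCoeff_taylorSeries, H.h_zero]
  have hT0' : PowerSeries.constantCoeff (taylorSeries h') = 0 := by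
    simpa using (isOddAnalytic_iff ho'.1).1 ho' 0
  rw [isOddAnalytic_iff H.analyticAt_h]
  -- The series of the normal form's `h` is `a` in all degrees, whereas that of `h'` is known to
  -- agree with `a` only up to degree `M - 1`. This range contains every even degree that the bound
  -- `M₀` requires.
  have hah : ∀ i, PowerSeries.coeff i (taylorSeries h) = PowerSeries.coeff i a := fun i =>
    PowerSeries.coeff_eq_of_constantCoeff_pSeq_eq hT0 a0 (n := i)
      (fun k hk _ => by rw [haQ k hk, ← seqP_zero_eq H.analyticAt_h, hPQ]) i le_rfl
  have hah' : ∀ i ≤ M - 1, PowerSeries.coeff i (taylorSeries h') = PowerSeries.coeff i a :=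
    PowerSeries.coeff_eq_of_constantCoeff_pSeq_eq hT0' a0
      fun k hk hkM => by rw [haQ k hk, ← seqP_zero_eq ho'.1, hPQ' k (by omega)]
  intro j
  rw [hah]
  refine ha (fun j hj => ?_) j
  rw [← hah' _ (by omega)]
  exact (isOddAnalytic_iff ho'.1).1 ho' j
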